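/- For integers $n,d$ and a real $\lambda$, an $(n,d,\lambda)$ graph is a $d$-regular (simple) graph on $n$ vertices whose largest nontrivial eigenvalue in absolute value is $\lambda$: $\lambda=\max_{i\ge 2}|\lambda_i|$, where $d=\lambda_1\ge\lambda_2\ge\dots\ge\lambda_n$ are the eigenvalues of its adjacency matrix. A non-backtracking random walk of length $m$ on $G$ from $u$ is a random sequence $(w_0,\dots,w_m)$ with $w_0=u$, where $w_1$ is uniform over the neighbours of $w_0$ and, for $i\ge 2$, given $w_0,\dots,w_{i-1}$, the vertex $w_i$ is uniform over the neighbours of $w_{i-1}$ other than $w_{i-2}$. Fix an integer $d\ge 3$, a real $\lambda<d$, an integer $r\ge 1$, and reals $\mu>0$ and $c>6$. Then there are $C$ and $n_0$, depending only on $d,\lambda,r,\mu,c$, such that the following holds for all $n\ge n_0$. Let $G$ be an $(n,d,\lambda')$ graph with $\lambda'\le\lambda$, let $g\ge c\log_{d-1}\log n$ be a real number such that the girth of $G$ is at least $g$, let $v_1,\dots,v_r$ be vertices of $G$ whose pairwise distances are at least $g$, and let $m$ be an integer with $|m-\mu n|<1$ (that is, $m=\mu n$ up to rounding up or down). Let $(w_0,\dots,w_m)$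 be a non-backtracking random walk of length $m$ on $G$ from $w_0=v_1$, and let $X_i=|\{1\le j\le m: w_j=v_i\}|$ be the number of visits that it makes to $v_i$. Then, with $Z\sim\operatorname{Po}(\mu)$ a Poisson variable with mean $\mu$, $$\left|\frac{\Pr\left[\bigcap_{i=1}^r \{X_i=t_i\}\right]}{\prod_{i=1}^r\Pr[Z=t_i]}-1\right|\le C(\log n)^{\frac{6-c}{4}}\qquad\text{for all } t_1,\dots,t_r\in\{0,1,\dots,\lfloor\log n\rfloor\}.$$ -/

import Mathlib

open Finset Filter
open scoped NNReal

/-- `θ` is a nontrivial eigenvalue of the regular graph `G`: it is an eigenvalue of the adjacency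
matrix with an eigenvector orthogonal to the constant vector (the constant vector carries
the trivial eigenvalue, the degree). For a regular graph this is the spectrum, counted with
multiplicity, from which one copy of the degree has been removed. -/
def IsNontrivialEigenvalue {V : Type*} [Fintype V] (G : SimpleGraph V) [DecidableRel G.Adj]
    (θ : ℝ) : Prop :=
  ∃ f : V → ℝ, f ≠ 0 ∧ ∑ x, f x = 0 ∧ (G.adjMatrix ℝ).mulVec f = θ • f

/-- `G` is an `(n, d, lam)` graph: a `d`-regular graph on `n` vertices whose largest nontrivial
eigenvalue in absolute value is `lam`. -/
structure IsNDLambdaGraph {V : Type*} [Fintype V] (G : SimpleGraph V) [DecidableRel G.Adj]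
    (n d : ℕ) (lam : ℝ) : Prop where
  card_eq : Fintype.card V = n
  regular : G.IsRegularOfDegree d
  isGreatest : IsGreatest {a : ℝ | ∃ θ : ℝ, IsNontrivialEigenvalue G θ ∧ a = |θ|} lam

/-- The vertices to which a non-backtracking walk `(w 0, …, w k)` may move next: the neighbours
of `w k` other than `w (k - 1)`; if `k = 0`, all neighbours of `w 0`. -/
def nbCandidates {V : Type*} [Fintype V] [DecidableEq V] (G : SimpleGraph V)
    [DecidableRel G.Adj] {k : ℕ} (w : Fin (k + 1) → V) : Finset V :=
  {x | G.Adj (w (Fin.last k)) x ∧ ∀ j : Fin (k + 1), (j : ℕ) + 1 = k → x ≠ w j}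

open Classical in
/-- The law of the next vertex of the non-backtracking random walk with past `(w 0, …, w k)`:
uniform over the admissible vertices. (If there is none, which cannot happen when all degrees
are at least two, the walk stays where it is.) -/
noncomputable def nbStep {V : Type*} [Fintype V] [DecidableEq V] (G : SimpleGraph V)
    [DecidableRel G.Adj] {k : ℕ} (w : Fin (k + 1) → V) : PMF V :=
  if h : (nbCandidates G w).Nonempty then PMF.uniformOfFinset (nbCandidates G w) h
  else PMF.pure (w (Fin.last k))

/-- The law of the non-backtracking random walk `(w 0, …, w m)` of length `m` on `G` that starts
from `w 0 = u`. -/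
noncomputable def nbWalk {V : Type*} [Fintype V] [DecidableEq V] (G : SimpleGraph V)
    [DecidableRel G.Adj] (u : V) : (m : ℕ) → PMF (Fin (m + 1) → V)
  | 0 => PMF.pure fun _ => u
  | m + 1 => (nbWalk G u m).bind fun w =>
      (nbStep G w).map fun x => (Fin.snoc w x : Fin (m + 2) → V)

/-- The number of visits of the walk `(w 0, …, w m)` to `x` at the positions `1, …, m`. -/
def visits {V : Type*} [DecidableEq V] {m : ℕ} (w : Fin (m + 1) → V) (x : V) : ℕ :=
  #{j : Fin m | w j.succ = x}

/-! The proof is the method of factorial moments. Write `L = log n`. The binomial moments of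
independent Poisson(`μ`) variables are `∏ μ ^ s i / (s i)!`. Those of the visit counts are expanded
according to the times of the chosen visits. The walk is Markov on directed edges, so only the
probability of being at `v i` exactly `j` steps after a given edge is needed.

For `j ≥ T`, with `T` of order `L`, this probability is `1/n` up to `1/n²`: the transfer operator
acts on the lift of each adjacency eigenfunction through a two-term recurrence whose characteristic
roots have modulus at most some `ρ < 1` (`nbOp_pow_indicator_mixing`). For `1 ≤ j < T` and a walk
that has just been at some `v l`, it is at most a constant times `L ^ (-c/2)`. Below about `g/2`
steps no return or passage is possible, and afterwards local uniqueness of non-backtracking walks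
gives a bound `(d-1) ^ (-h)` with `h` about `g/2` (`nbOp_pow_indicator_le_log_rpow`).

Quick returns thus have total mass of order `κ = L ^ (1 - c/2)`. Induction on the order `K`
(`visitMoment_le`, `le_visitMoment`) gives moments with relative error `(1 + Kκ) ^ K - 1`.
Inclusion-exclusion turns moments into probabilities (`abs_div_prod_poisson_sub_one_le`). For `K` of
order `L` the error is about `L² κ = L ^ ((6 - c)/2)`; for larger `K` factorial decay wins
(`poisson_weight_mul_error_le`). -/

/-- The transfer operator of the non-backtracking walk, acting on functions of directed edges:
the sum of `f` over the non-backtracking continuations of `(x, y)`, divided by `b`. -/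
noncomputable def nbOp {V : Type*} [Fintype V] [DecidableEq V] (G : SimpleGraph V)
    [DecidableRel G.Adj] (b : ℝ) : (V → V → ℝ) →ₗ[ℝ] (V → V → ℝ) where
  toFun f x y := (∑ z with G.Adj y z ∧ z ≠ x, f y z) / b
  map_add' f g := by
    ext x y
    simp [sum_add_distrib, add_div]
  map_smul' a f := by
    ext x y
    simp [← mul_sum, mul_div_assoc]

/-! ### Spectral theory of the transfer operator. -/

section Operator

variable {V : Type*} [Fintype V] [DecidableEq V] (G : SimpleGraph V) [DecidableRel G.Adj]

lemma nbOp_apply (b : ℝ) (f : V → V → ℝ) (x y : V) :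
    nbOp G b f x y = (∑ z with G.Adj y z ∧ z ≠ x, f y z) / b := rfl

variable {G}

lemma nbOp_mono {b : ℝ} (hb : 0 ≤ b) {f g : V → V → ℝ}
    (h : ∀ x y, G.Adj x y → f x y ≤ g x y) (x y : V) : nbOp G b f x y ≤ nbOp G b g x y := by
  rw [nbOp_apply, nbOp_apply]
  refine div_le_div_of_nonneg_right (sum_le_sum fun z hz => ?_) hb
  exact h _ _ (mem_filter.1 hz).2.1

lemma nbOp_pow_mono {b : ℝ} (hb : 0 ≤ b) {f g : V → V → ℝ}
    (h : ∀ x y, G.Adj x y → f x y ≤ g x y) (k : ℕ) {x y : V} (hxy : G.Adj x y) :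
    (nbOp G b ^ k) f x y ≤ (nbOp G b ^ k) g x y := by
  induction k generalizing x y with
  | zero => simpa using h x y hxy
  | succ k ih =>
    rw [pow_succ', Module.End.mul_apply, Module.End.mul_apply]
    exact nbOp_mono hb (fun x y hxy => ih hxy) x y

/-- Functions live on all pairs, but the operator reads only values on edges; values elsewhere are
irrelevant. -/
lemma nbOp_congr {b : ℝ} {f g : V → V → ℝ}
    (h : ∀ x y, G.Adj x y → f x y = g x y) : nbOp G b f = nbOp G b g := by
  ext x y
  rw [nbOp_apply, nbOp_apply]
  congr 1
  exact sum_congr rfl fun z hz => h _ _ (mem_filter.1 hz).2.1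

lemma filter_adj_ne_eq_erase (x y : V) :
    (univ.filter fun z => G.Adj y z ∧ z ≠ x) = (G.neighborFinset y).erase x := by
  ext z
  simp [and_comm]

lemma sum_filter_adj_ne {x y : V} (hxy : G.Adj x y) (f : V → ℝ) :
    ∑ z with G.Adj y z ∧ z ≠ x, f z = ∑ z ∈ G.neighborFinset y, f z - f x := by
  rw [filter_adj_ne_eq_erase, sum_erase_eq_sub]
  simpa using hxy.symm

lemma card_filter_adj_ne {d : ℕ} (hG : G.IsRegularOfDegree d) {x y : V} (hxy : G.Adj x y) :
    (#{z | G.Adj y z ∧ z ≠ x} : ℝ) = (d : ℝ) - 1 := by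
  have h := sum_filter_adj_ne hxy (fun _ => (1 : ℝ))
  simp only [sum_const, nsmul_eq_mul, mul_one, G.card_neighborFinset_eq_degree] at h
  rw [h, hG y]

/-- The coefficients of `φ y` and `φ x` in the `k`-th iterate of `nbOp` on an eigenfunction `φ`. -/
noncomputable def nbCoeff (b θ : ℝ) : ℕ → ℝ × ℝ
  | 0 => (1, 0)
  | k + 1 => ((nbCoeff b θ k).1 * (θ / b) + (nbCoeff b θ k).2, -(nbCoeff b θ k).1 / b)

/-- The span of the two lifts `φ y` and `φ x` is invariant: summing `φ z` over `z ≠ x` gives `θ φ y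
- φ x`, while `φ y` is repeated `d - 1` times. -/
lemma nbOp_pow_eigenfunction {d : ℕ} (hG : G.IsRegularOfDegree d) (hd : (d : ℝ) - 1 ≠ 0)
    {φ : V → ℝ} {θ : ℝ} (hφ : ∀ y, ∑ z ∈ G.neighborFinset y, φ z = θ * φ y) (k : ℕ) {x y : V}
    (hxy : G.Adj x y) :
    (nbOp G ((d : ℝ) - 1) ^ k) (fun _ y => φ y) x y
      = (nbCoeff (d - 1) θ k).1 * φ y + (nbCoeff (d - 1) θ k).2 * φ x := by
  induction k generalizing x y with
  | zero => simp [nbCoeff]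
  | succ k ih =>
    rw [pow_succ', Module.End.mul_apply, nbOp_congr (fun x y hxy => ih hxy), nbOp_apply,
      sum_filter_adj_ne hxy fun z => (nbCoeff (d - 1) θ k).1 * φ z + (nbCoeff (d - 1) θ k).2 * φ y,
      sum_add_distrib, ← mul_sum, hφ, sum_const, G.card_neighborFinset_eq_degree, hG y, nbCoeff]
    simp only [nsmul_eq_mul]
    field_simp
    ring

end Operator

/-- These are the roots of `X² - τX + δ`. Real roots lie in `[-ρ, ρ]` because the polynomial is
nonnegative at `±ρ` and `|τ| ≤ 2ρ`; conjugate roots have squared modulus `δ`. -/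
lemma exists_roots_norm_le {τ δ ρ : ℝ} (hρ : 0 < ρ) (h1 : δ ≤ ρ ^ 2)
    (h2 : 0 ≤ ρ ^ 2 - |τ| * ρ + δ) :
    ∃ α β : ℂ, α + β = τ ∧ α * β = δ ∧ ‖α‖ ≤ ρ ∧ ‖β‖ ≤ ρ := by
  rcases le_or_gt 0 (τ ^ 2 - 4 * δ) with hD | hD
  · set s := Real.sqrt (τ ^ 2 - 4 * δ) with hs
    have hs0 : 0 ≤ s := Real.sqrt_nonneg _
    have hs2 : s ^ 2 = τ ^ 2 - 4 * δ := Real.sq_sqrt hD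
    have hτ : |τ| ≤ 2 * ρ := by
      by_contra! h
      nlinarith
    have hsle : s ≤ 2 * ρ - |τ| := by
      apply Real.sqrt_le_iff.2 ⟨by linarith, ?_⟩
      nlinarith [sq_abs τ]
    refine ⟨((τ + s) / 2 : ℝ), ((τ - s) / 2 : ℝ), ?_, ?_, ?_, ?_⟩
    · rw [← Complex.ofReal_add]; congr 1; ring
    · rw [← Complex.ofReal_mul]; congr 1; nlinarith
    · rw [Complex.norm_real, Real.norm_eq_abs, abs_le]
      constructor <;> linarith [neg_abs_le τ, le_abs_self τ]
    · rw [Complex.norm_real, Real.norm_eq_abs, abs_le]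
      constructor <;> linarith [neg_abs_le τ, le_abs_self τ]
  · set s := Real.sqrt (4 * δ - τ ^ 2) with hs
    have hs2 : s ^ 2 = 4 * δ - τ ^ 2 := Real.sq_sqrt (by linarith)
    have key : ∀ u : ℝ, u ^ 2 = s ^ 2 → ‖(⟨τ / 2, u / 2⟩ : ℂ)‖ ≤ ρ := by
      intro u hu
      apply le_of_sq_le_sq _ hρ.le
      rw [Complex.sq_norm, Complex.normSq_mk]
      nlinarith
    refine ⟨⟨τ / 2, s / 2⟩, ⟨τ / 2, -s / 2⟩, ?_, ?_, key s rfl, key (-s) (by ring)⟩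
    · apply Complex.ext
      · simp
      · simp; ring
    · apply Complex.ext
      · simp; nlinarith
      · simp; ring

lemma abs_nbCoeff_le {b θ ρ : ℝ} (hb : 0 < b) (hρ : 0 < ρ) (hρ1 : ρ ≤ 1) (h1 : 1 / b ≤ ρ ^ 2)
    (h2 : 0 ≤ ρ ^ 2 - |θ / b| * ρ + 1 / b) (k : ℕ) :
    |(nbCoeff b θ k).1| ≤ (k + 1) * ρ ^ k ∧ |(nbCoeff b θ k).2| ≤ (k + 1) * ρ ^ k := by
  obtain ⟨α, β, hs, hp, hα, hβ⟩ := exists_roots_norm_le hρ h1 h2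
  -- This reduces the recurrence to first order without dividing by `α - β`, so double roots need no
  -- separate case; they are why the factor `k + 1` appears.
  have inv : ∀ k, (((nbCoeff b θ k).2 : ℝ) : ℂ) = β ^ (k + 1) - β * ((nbCoeff b θ k).1 : ℝ) := by
    intro k
    induction k with
    | zero => simp [nbCoeff]
    | succ k ih =>
      have e : (((-(nbCoeff b θ k).1 / b : ℝ)) : ℂ) = -(α * β) * ((nbCoeff b θ k).1 : ℝ) := by
        rw [hp]; push_cast; ring
      rw [nbCoeff, e]
      push_cast
      rw [ih]
      have hs' : (θ : ℂ) / b = α + β := by rw [hs]; push_cast; rfl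
      rw [hs']
      ring
  have fst : ∀ k, |(nbCoeff b θ k).1| ≤ (k + 1) * ρ ^ k := by
    intro k
    induction k with
    | zero => simp [nbCoeff]
    | succ k ih =>
      have e : (((nbCoeff b θ (k + 1)).1 : ℝ) : ℂ) = α * ((nbCoeff b θ k).1 : ℝ) + β ^ (k + 1) := by
        rw [nbCoeff]
        push_cast
        rw [inv k]
        have hs' : (θ : ℂ) / b = α + β := by rw [hs]; push_cast; rfl
        rw [hs']
        ring
      rw [← Real.norm_eq_abs, ← Complex.norm_real, e]
      calc ‖α * ((nbCoeff b θ k).1 : ℝ) + β ^ (k + 1)‖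
          ≤ ‖α‖ * |(nbCoeff b θ k).1| + ‖β‖ ^ (k + 1) := by
            refine (norm_add_le _ _).trans_eq ?_
            rw [norm_mul, norm_pow, Complex.norm_real, Real.norm_eq_abs]
        _ ≤ ρ * ((k + 1) * ρ ^ k) + ρ ^ (k + 1) := by gcongr
        _ = ((k + 1 : ℕ) + 1) * ρ ^ (k + 1) := by push_cast; ring
  refine ⟨fst k, ?_⟩
  cases k with
  | zero => simp [nbCoeff]
  | succ k =>
    rw [nbCoeff, neg_div, abs_neg, abs_div, abs_of_pos hb, div_eq_mul_one_div]
    calc |(nbCoeff b θ k).1| * (1 / b) ≤ ((k + 1) * ρ ^ k) * ρ ^ 2 := by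
          gcongr
          exact fst k
      _ = (k + 1) * ρ ^ (k + 1) * ρ := by ring
      _ ≤ (k + 1) * ρ ^ (k + 1) * 1 := by gcongr
      _ ≤ ((k + 1 : ℕ) + 1) * ρ ^ (k + 1) := by
          rw [mul_one]; gcongr; linarith

/-- Both inequalities are strict at `ρ = 1`, hence persist slightly below 1. -/
lemma exists_contraction_rate {b lam : ℝ} (hb : 1 < b) (hlam : lam < b + 1) :
    ∃ ρ : ℝ, 0 < ρ ∧ ρ < 1 ∧ 1 / b ≤ ρ ^ 2 ∧ 0 ≤ ρ ^ 2 - lam / b * ρ + 1 / b := by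
  have hb0 : 0 < b := by linarith
  have c1 : ∀ᶠ ρ : ℝ in nhds 1, 0 < ρ := lt_mem_nhds one_pos
  have c2 : ∀ᶠ ρ : ℝ in nhds 1, 1 / b < ρ ^ 2 := by
    have : ContinuousAt (fun ρ : ℝ => ρ ^ 2) 1 := by fun_prop
    apply this.eventually_const_lt
    rw [div_lt_iff₀ hb0]; linarith
  have c3 : ∀ᶠ ρ : ℝ in nhds 1, 0 < ρ ^ 2 - lam / b * ρ + 1 / b := by
    have : ContinuousAt (fun ρ : ℝ => ρ ^ 2 - lam / b * ρ + 1 / b) 1 := by fun_prop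
    apply this.eventually_const_lt
    have : (1 : ℝ) ^ 2 - lam / b * 1 + 1 / b = (b + 1 - lam) / b := by field_simp; ring
    change 0 < (1 : ℝ) ^ 2 - lam / b * 1 + 1 / b
    rw [this]
    exact div_pos (by linarith) hb0
  have h := (c1.and (c2.and c3)).filter_mono (nhdsWithin_le_nhds (s := Set.Iio 1))
  obtain ⟨ρ, ⟨h1, h2, h3⟩, h4⟩ := (h.and self_mem_nhdsWithin).exists
  exact ⟨ρ, h1, h4, h2.le, h3.le⟩

/-- An eigenvector of a regular graph either has eigenvalue bounded by the nontrivial ones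
or is constant. -/
lemma eigenvalue_le_or_const {V : Type*} [Fintype V] {G : SimpleGraph V} [DecidableRel G.Adj]
    {n d : ℕ} {lam' : ℝ} (hG : IsNDLambdaGraph G n d lam')
    (hlam : lam' < d) {e : V → ℝ} (he0 : e ≠ 0) {θ : ℝ}
    (he : (G.adjMatrix ℝ).mulVec e = θ • e) : |θ| ≤ lam' ∨ ∃ a, ∀ x, e x = a := by
  by_cases hs : ∑ x, e x = 0
  · exact Or.inl (hG.isGreatest.2 ⟨θ, ⟨e, he0, hs, he⟩, rfl⟩)
  right
  have hdeg : ∀ x, ∑ y, G.adjMatrix ℝ x y = d := by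
    intro x
    have := hG.regular x
    simp [SimpleGraph.adjMatrix_apply, ← this, SimpleGraph.degree,
      SimpleGraph.neighborFinset_eq_filter]
  have hdeg' : ∀ y, ∑ x, G.adjMatrix ℝ x y = d := by
    intro y
    rw [← hdeg y]
    exact sum_congr rfl fun x _ => by simp [SimpleGraph.adjMatrix_apply, G.adj_comm]
  have hθ : θ = d := by
    have h : ∑ x, (G.adjMatrix ℝ).mulVec e x = θ * ∑ x, e x := by
      rw [he, mul_sum]; rfl
    have h' : ∑ x, (G.adjMatrix ℝ).mulVec e x = d * ∑ x, e x := by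
      simp only [Matrix.mulVec, dotProduct]
      rw [sum_comm, mul_sum]
      exact sum_congr rfl fun y _ => by rw [← sum_mul, hdeg']
    exact mul_right_cancel₀ hs (h.symm.trans h')
  set a : ℝ := (∑ x, e x) / n with ha
  refine ⟨a, ?_⟩
  by_contra! hne
  obtain ⟨x0, hx0⟩ := hne
  have hn : (n : ℝ) ≠ 0 := by
    rw [← hG.card_eq]
    have : Nonempty V := ⟨x0⟩
    exact_mod_cast Fintype.card_ne_zero
  -- Subtracting its mean from a non-constant `e` would make `d` a nontrivial eigenvalue.
  have hnt : IsNontrivialEigenvalue G d := by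
    refine ⟨fun x => e x - a, fun h => hx0 (sub_eq_zero.1 (congrFun h x0)), ?_, ?_⟩
    · rw [sum_sub_distrib, sum_const, card_univ, hG.card_eq, nsmul_eq_mul, ha]
      field_simp
      ring
    · ext x
      have h := congrFun he x
      simp only [Matrix.mulVec, dotProduct, Pi.smul_apply, smul_eq_mul] at h ⊢
      simp only [mul_sub, sum_sub_distrib, h, ← sum_mul, hdeg, hθ]
  have := hG.isGreatest.2 ⟨d, hnt, rfl⟩
  rw [abs_of_nonneg (Nat.cast_nonneg d)] at this
  linarith

/-! ### Mixing of the walk. -/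

section Mixing

variable {V : Type*} [Fintype V] [DecidableEq V] {G : SimpleGraph V} [DecidableRel G.Adj]

lemma nbOp_pow_one {d : ℕ} (hG : G.IsRegularOfDegree d) (hd : (d : ℝ) - 1 ≠ 0) (a : ℝ) (k : ℕ)
    {x y : V} (hxy : G.Adj x y) :
    (nbOp G ((d : ℝ) - 1) ^ k) (fun _ _ => a) x y = a := by
  induction k generalizing x y with
  | zero => simp
  | succ k ih =>
    rw [pow_succ', Module.End.mul_apply, nbOp_congr (fun x y hxy => ih hxy), nbOp_apply, sum_const,
      nsmul_eq_mul, card_filter_adj_ne hG hxy]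
    field_simp

/-- The non-backtracking walk on an `(n, d, lam')` graph mixes at an explicit rate. -/
lemma nbOp_pow_indicator_mixing {n d : ℕ} {lam' ρ : ℝ} (hd : 2 ≤ d)
    (hG : IsNDLambdaGraph G n d lam')
    (hlam : lam' < d) (hρ : 0 < ρ) (hρ1 : ρ ≤ 1) (h1 : 1 / ((d : ℝ) - 1) ≤ ρ ^ 2)
    (h2 : 0 ≤ ρ ^ 2 - lam' / ((d : ℝ) - 1) * ρ + 1 / ((d : ℝ) - 1)) (k : ℕ) (z : V) {x y : V}
    (hxy : G.Adj x y) :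
    |(nbOp G ((d : ℝ) - 1) ^ k) (fun _ y => if y = z then 1 else 0) x y - 1 / n|
      ≤ 2 * ((k + 1) * ρ ^ k) := by
  have hd' : (2 : ℝ) ≤ d := by exact_mod_cast hd
  have hb : (0 : ℝ) < d - 1 := by linarith
  have hn : (1 : ℝ) ≤ n := by
    rw [← hG.card_eq]
    have : Nonempty V := ⟨z⟩
    exact_mod_cast Fintype.card_pos
  have hA : (G.adjMatrix ℝ).IsHermitian := by
    rw [Matrix.IsHermitian, Matrix.conjTranspose_eq_transpose_of_trivial]
    exact G.isSymm_adjMatrix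
  set e := hA.eigenvectorBasis with he
  set φ : EuclideanSpace ℝ V := WithLp.toLp 2 fun y => (if y = z then (1 : ℝ) else 0) - 1 / n
    with hφ
  set c : V → ℝ := fun i => inner ℝ (e i) φ with hc
  have hsum : ∑ y, φ y = 0 := by
    simp [hφ, sum_sub_distrib, hG.card_eq]
    field_simp
    ring
  have hcsq : ∑ i, c i ^ 2 ≤ 1 := by
    have h : ∑ i, c i ^ 2 = ‖φ‖ ^ 2 := by
      rw [← e.sum_sq_norm_inner_right φ]
      exact sum_congr rfl fun i _ => by rw [Real.norm_eq_abs, sq_abs]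
    have e1 : ∀ y, φ y ^ 2 = (if y = z then (1 - 2 / n : ℝ) else 0) + 1 / n ^ 2 := by
      intro y
      simp only [hφ]
      split_ifs <;> ring
    rw [h, EuclideanSpace.real_norm_sq_eq, sum_congr rfl fun y _ => e1 y, sum_add_distrib,
      sum_ite_eq' univ z, if_pos (mem_univ _), sum_const, card_univ, hG.card_eq, nsmul_eq_mul]
    have : (n : ℝ) * (1 / n ^ 2) = 1 / n := by field_simp
    rw [this]
    have : (2 : ℝ) / n = 2 * (1 / n) := by ring
    have : (0 : ℝ) < 1 / n := by positivity
    linarith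
  have hesq : ∀ y, ∑ i, e i y ^ 2 = 1 := by
    intro y
    have h := e.sum_sq_norm_inner_right (EuclideanSpace.single y (1 : ℝ))
    simpa [EuclideanSpace.inner_single_right] using h
  -- Parseval in both factors keeps the bound free of `n`.
  have hcs : ∀ y, ∑ i, |c i| * |e i y| ≤ 1 := by
    intro y
    calc ∑ i, |c i| * |e i y| ≤ ∑ i, (c i ^ 2 + e i y ^ 2) / 2 := by
          refine sum_le_sum fun i _ => ?_
          nlinarith [sq_nonneg (|c i| - |e i y|), sq_abs (c i), sq_abs (e i y)]
      _ = (∑ i, c i ^ 2 + ∑ i, e i y ^ 2) / 2 := by rw [← sum_div, sum_add_distrib]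
      _ ≤ 1 := by rw [hesq]; linarith
  have hexp : (fun (_ : V) y => if y = z then (1 : ℝ) else 0)
      = (fun _ _ => (1 / n : ℝ)) + ∑ i, c i • fun (_ : V) y => e i y := by
    ext x y
    have h := congrArg (fun ψ : EuclideanSpace ℝ V => ψ y) (e.sum_repr' φ)
    simp only [WithLp.ofLp_sum, Finset.sum_apply, WithLp.ofLp_smul, Pi.smul_apply, smul_eq_mul] at h
    simp only [Pi.add_apply, Finset.sum_apply, Pi.smul_apply, smul_eq_mul]
    simp only [hc]
    rw [h]
    simp [hφ]
  have heig : ∀ i y, ∑ w ∈ G.neighborFinset y, e i w = hA.eigenvalues i * e i y := by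
    intro i y
    have h := congrFun (hA.mulVec_eigenvectorBasis i) y
    rw [SimpleGraph.adjMatrix_mulVec_apply] at h
    simpa using h
  have hcoef : ∀ i, c i ≠ 0 → |(nbCoeff (d - 1) (hA.eigenvalues i) k).1| ≤ (k + 1) * ρ ^ k ∧
      |(nbCoeff (d - 1) (hA.eigenvalues i) k).2| ≤ (k + 1) * ρ ^ k := by
    intro i hi
    have hne : (fun x => e i x) ≠ 0 := by
      intro h0
      apply e.orthonormal.ne_zero i
      ext x
      exact congrFun h0 x
    rcases eigenvalue_le_or_const hG hlam hne (hA.mulVec_eigenvectorBasis i) with h | ⟨a, ha⟩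
    · apply abs_nbCoeff_le hb hρ hρ1 h1
      rw [abs_div, abs_of_pos hb]
      have : |hA.eigenvalues i| / (d - 1) * ρ ≤ lam' / (d - 1) * ρ := by gcongr
      linarith
    -- A constant eigenvector is orthogonal to the mean-zero `φ`, so its coefficient vanishes.
    · exfalso
      apply hi
      simp only [hc, PiLp.inner_apply]
      have : ∀ x, inner ℝ (e i x) (φ x) = a * φ x := by
        intro x
        rw [← ha x]
        simp [mul_comm]
      rw [sum_congr rfl fun x _ => this x, ← mul_sum, hsum, mul_zero]
  rw [hexp, map_add, map_sum]
  simp only [Pi.add_apply, Finset.sum_apply, map_smul, Pi.smul_apply, smul_eq_mul]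
  rw [nbOp_pow_one hG.regular hb.ne' _ k hxy, add_sub_cancel_left]
  calc |∑ i, c i * (nbOp G ((d : ℝ) - 1) ^ k) (fun _ y => e i y) x y|
      ≤ ∑ i, ((k + 1) * ρ ^ k) * (|c i| * |e i y| + |c i| * |e i x|) := by
        refine (abs_sum_le_sum_abs _ _).trans (sum_le_sum fun i _ => ?_)
        rw [nbOp_pow_eigenfunction hG.regular hb.ne' (heig i) k hxy, abs_mul]
        by_cases hi : c i = 0
        · simp [hi]
        obtain ⟨k1, k2⟩ := hcoef i hi
        calc |c i| * _ ≤ |c i| * ((k + 1) * ρ ^ k * |e i y| + (k + 1) * ρ ^ k * |e i x|) := by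
              gcongr
              refine (abs_add_le _ _).trans ?_
              rw [abs_mul, abs_mul]
              gcongr
          _ = _ := by ring
    _ = ((k + 1) * ρ ^ k) * (∑ i, |c i| * |e i y| + ∑ i, |c i| * |e i x|) := by
        rw [← mul_sum, sum_add_distrib]
    _ ≤ ((k + 1) * ρ ^ k) * (1 + 1) := by
        gcongr
        · exact hcs y
        · exact hcs x
    _ = _ := by ring

end Mixing

/-! ### Short non-backtracking walks in a graph of large girth. -/

namespace SimpleGraph

variable {V : Type*} {G : SimpleGraph V}

/-- A cycle has distinct edges, so one inside `E` would be shorter than the girth. This reduces walk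
questions to forests. -/
lemma isAcyclic_fromEdgeSet_of_card_lt_girth [DecidableEq V] {E : Finset (Sym2 V)}
    (hE : (E : Set (Sym2 V)) ⊆ G.edgeSet) (hg : #E < G.girth) :
    (fromEdgeSet (E : Set (Sym2 V))).IsAcyclic := by
  intro a w hw
  have hmem : ∀ e ∈ w.edges, e ∈ E := by
    intro e he
    have := w.edges_subset_edgeSet he
    rw [edgeSet_fromEdgeSet] at this
    exact this.1
  have hlen : w.length ≤ #E := by
    rw [← w.length_edges, ← List.toFinset_card_of_nodup hw.edges_nodup]
    exact card_le_card fun e he => hmem e (List.mem_toFinset.1 he)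
  have hc := hw.transfer (H := G) fun e he => hE (hmem e he)
  have := girth_le_length hc
  rw [Walk.length_transfer] at this
  omega

/-- Short non-backtracking walks are paths. -/
lemma Walk.isPath_of_isChain_of_length_lt_girth {x y : V} (p : G.Walk x y)
    (hp : p.edges.IsChain (· ≠ ·)) (hg : p.length < G.girth) : p.IsPath := by
  classical
  have hE : ((p.edges.toFinset : Finset (Sym2 V)) : Set (Sym2 V)) ⊆ G.edgeSet := fun e he =>
    p.edges_subset_edgeSet (List.mem_toFinset.1 he)
  have hac := isAcyclic_fromEdgeSet_of_card_lt_girth hE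
    ((List.toFinset_card_le _).trans_lt (by rwa [p.length_edges]))
  have hH : ∀ e ∈ p.edges, e ∈ (fromEdgeSet (p.edges.toFinset : Set (Sym2 V))).edgeSet := by
    intro e he
    rw [edgeSet_fromEdgeSet]
    exact ⟨List.mem_toFinset.2 he, G.not_isDiag_of_mem_edgeSet (p.edges_subset_edgeSet he)⟩
  have := (hac.isPath_iff_isChain (p.transfer _ hH)).2 (by rwa [Walk.edges_transfer])
  rwa [Walk.isPath_def, Walk.support_transfer, ← Walk.isPath_def] at this

/-- Short non-backtracking walks are determined by their endpoints. -/
lemma Walk.eq_of_isChain_of_length_add_lt_girth {x y : V} (p q : G.Walk x y)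
    (hp : p.edges.IsChain (· ≠ ·)) (hq : q.edges.IsChain (· ≠ ·))
    (hg : p.length + q.length < G.girth) : p = q := by
  classical
  set E : Finset (Sym2 V) := p.edges.toFinset ∪ q.edges.toFinset with hEdef
  have hE : (E : Set (Sym2 V)) ⊆ G.edgeSet := by
    intro e he
    rcases mem_union.1 (mem_coe.1 he) with h | h
    · exact p.edges_subset_edgeSet (List.mem_toFinset.1 h)
    · exact q.edges_subset_edgeSet (List.mem_toFinset.1 h)
  have hcard : #E < G.girth := by
    refine (card_union_le _ _).trans_lt (lt_of_le_of_lt ?_ hg)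
    rw [← p.length_edges, ← q.length_edges]
    exact add_le_add (List.toFinset_card_le _) (List.toFinset_card_le _)
  have hac := isAcyclic_fromEdgeSet_of_card_lt_girth hE hcard
  have hedge : ∀ e ∈ E, e ∈ (fromEdgeSet (E : Set (Sym2 V))).edgeSet := by
    intro e he
    rw [edgeSet_fromEdgeSet]
    exact ⟨he, G.not_isDiag_of_mem_edgeSet (hE he)⟩
  have hpH : ∀ e ∈ p.edges, e ∈ (fromEdgeSet (E : Set (Sym2 V))).edgeSet := fun e he =>
    hedge e (mem_union_left _ (List.mem_toFinset.2 he))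
  have hqH : ∀ e ∈ q.edges, e ∈ (fromEdgeSet (E : Set (Sym2 V))).edgeSet := fun e he =>
    hedge e (mem_union_right _ (List.mem_toFinset.2 he))
  have h1 := (hac.isPath_iff_isChain (p.transfer _ hpH)).2 (by rwa [Walk.edges_transfer])
  have h2 := (hac.isPath_iff_isChain (q.transfer _ hqH)).2 (by rwa [Walk.edges_transfer])
  have h3 := congrArg (fun w : (fromEdgeSet (E : Set (Sym2 V))).Path x y =>
    (w : (fromEdgeSet (E : Set (Sym2 V))).Walk x y).support) ((hac.subsingleton_path x y).elim ⟨_, h1⟩ ⟨_, h2⟩)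
  apply Walk.ext_support
  simpa using h3

end SimpleGraph

/-! ### Hitting probabilities at short times. -/

section LocalBounds

variable {V : Type*} [Fintype V] [DecidableEq V] {G : SimpleGraph V} [DecidableRel G.Adj]

lemma exists_walk_of_nbOp_pow_ne_zero {b : ℝ} {k : ℕ} {z x y : V} (hxy : G.Adj x y)
    (h : (nbOp G b ^ k) (fun _ y => if y = z then 1 else 0) x y ≠ 0) :
    ∃ q : G.Walk y z, q.length = k ∧
      (SimpleGraph.Walk.cons hxy q).edges.IsChain (· ≠ ·) := by
  induction k generalizing x y with
  | zero =>
    have hyz : y = z := by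
      by_contra hne
      simp [hne] at h
    subst hyz
    exact ⟨.nil, rfl, by simp⟩
  | succ k ih =>
    rw [pow_succ', Module.End.mul_apply, nbOp_apply] at h
    obtain ⟨w, hw, hw0⟩ := exists_ne_zero_of_sum_ne_zero (div_ne_zero_iff.1 h).1
    obtain ⟨hyw, hwx⟩ := (mem_filter.1 hw).2
    obtain ⟨q, hq, hc⟩ := ih hyw hw0
    refine ⟨.cons hyw q, by simp [hq], ?_⟩
    rw [SimpleGraph.Walk.edges_cons] at hc ⊢
    rw [SimpleGraph.Walk.edges_cons, List.isChain_cons_cons]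
    refine ⟨?_, hc⟩
    intro he
    rcases Sym2.eq_iff.1 he with ⟨h1, -⟩ | ⟨h1, -⟩
    · exact hxy.ne h1
    · exact hwx h1.symm

/-- At each step at most one continuation can still reach `z` on time, since two would give distinct
short non-backtracking walks with the same ends. Each step therefore costs a factor `1 / b`. -/
lemma nbOp_pow_indicator_le_of_two_mul_lt_girth {b : ℝ} (hb : 0 < b) {k : ℕ}
    (hk : 2 * k < G.girth) (z : V) {x y : V} (hxy : G.Adj x y) :
    (nbOp G b ^ k) (fun _ y => if y = z then 1 else 0) x y ≤ (1 / b) ^ k := by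
  induction k generalizing x y with
  | zero =>
    simp only [pow_zero, Module.End.one_apply]
    split_ifs <;> norm_num
  | succ k ih =>
    rw [pow_succ', Module.End.mul_apply, nbOp_apply, pow_succ, ← div_eq_mul_one_div]
    refine div_le_div_of_nonneg_right ?_ hb.le
    by_cases hall : ∀ w ∈ univ.filter (fun w => G.Adj y w ∧ w ≠ x),
        (nbOp G b ^ k) (fun _ y => if y = z then 1 else 0) y w = 0
    · rw [sum_eq_zero hall]
      positivity
    push Not at hall
    obtain ⟨w, hw, hw0⟩ := hall
    have hyw := (mem_filter.1 hw).2.1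
    rw [sum_eq_single_of_mem w hw]
    · exact ih (by omega) hyw
    · intro w' hw' hne
      by_contra h0
      have hyw' := (mem_filter.1 hw').2.1
      obtain ⟨q, hq, hc⟩ := exists_walk_of_nbOp_pow_ne_zero hyw hw0
      obtain ⟨q', hq', hc'⟩ := exists_walk_of_nbOp_pow_ne_zero hyw' h0
      have h := SimpleGraph.Walk.eq_of_isChain_of_length_add_lt_girth _ _ hc hc'
        (by simp only [SimpleGraph.Walk.length_cons, hq, hq']; omega)
      exact hne (by injection h with h1 h2; exact h2.symm)

/-- The walk hits a given vertex at a given late time with small probability. -/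
lemma nbOp_pow_indicator_le {d : ℕ} (hd : 2 ≤ d) (hG : G.IsRegularOfDegree d) {h k : ℕ}
    (hh : 2 * h < G.girth) (hk : h ≤ k) (z : V) {x y : V} (hxy : G.Adj x y) :
    (nbOp G ((d : ℝ) - 1) ^ k) (fun _ y => if y = z then 1 else 0) x y
      ≤ (1 / ((d : ℝ) - 1)) ^ h := by
  have hd' : (2 : ℝ) ≤ d := by exact_mod_cast hd
  have hb : (0 : ℝ) < d - 1 := by linarith
  -- After the first `l` steps, whatever they are, the last `h` steps hit `z` with probability at
  -- most `(1 / b) ^ h`.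
  obtain ⟨l, rfl⟩ := Nat.exists_eq_add_of_le' hk
  rw [pow_add, Module.End.mul_apply, ← nbOp_pow_one hG hb.ne' ((1 / ((d : ℝ) - 1)) ^ h) l hxy]
  exact nbOp_pow_mono hb.le
    (fun x y hxy => nbOp_pow_indicator_le_of_two_mul_lt_girth hb hh z hxy) l hxy

/-- The walk does not travel quickly between vertices that are far from each other, nor does it
return quickly to its origin. -/
lemma nbOp_pow_indicator_eq_zero {ι : Type*} {v : ι → V} {g : ℝ} (hg : g ≤ G.girth)
    (hdist : ∀ i j, i ≠ j → g ≤ G.dist (v i) (v j)) {b : ℝ} {k : ℕ} (hk : 1 ≤ k)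
    (hkg : (k : ℝ) + 1 < g) (i : ι) {x y : V} (hxy : G.Adj x y)
    (hgood : (∃ j, x = v j) ∨ ∃ j, y = v j) :
    (nbOp G b ^ k) (fun _ y => if y = v i then 1 else 0) x y = 0 := by
  by_contra h0
  obtain ⟨q, hq, hc⟩ := exists_walk_of_nbOp_pow_ne_zero hxy h0
  have hlt : k + 1 < G.girth := by exact_mod_cast hkg.trans_le hg
  have far : ∀ j (w : G.Walk (v j) (v i)), w.edges.IsChain (· ≠ ·) → 1 ≤ w.length →
      w.length ≤ k + 1 → False := by
    intro j w hw h1 h2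
    by_cases hij : j = i
    · subst hij
      have := (w.isPath_of_isChain_of_length_lt_girth hw (by omega))
      rw [SimpleGraph.Walk.isPath_iff_nil, ← SimpleGraph.Walk.length_eq_zero_iff] at this
      omega
    · have h3 := hdist j i hij
      have h4 : (G.dist (v j) (v i) : ℝ) ≤ k + 1 := by
        exact_mod_cast (SimpleGraph.dist_le w).trans h2
      linarith
  rcases hgood with ⟨j, rfl⟩ | ⟨j, rfl⟩
  · exact far j _ hc (by simp) (by simp [hq])
  · rw [SimpleGraph.Walk.edges_cons] at hc
    exact far j q hc.tail (by omega) (by omega)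

end LocalBounds

/-! ### Expectations of visit counts and their binomial moments. -/

section VisitExpectation

variable {V : Type*} [Fintype V] [DecidableEq V] {ι : Type*}

/-- The contribution of a step to `z` to the vector of visits to the vertices `v i`. -/
def hitVector (v : ι → V) (z : V) : ι → ℕ := fun i => if z = v i then 1 else 0

/-- The expectation of `φ` at the vector of visits made to the vertices `v i` in the next `k`
steps of the non-backtracking walk whose last step is `(x, y)`. -/
noncomputable def visitExp (G : SimpleGraph V) [DecidableRel G.Adj] (b : ℝ) (v : ι → V) :
    ℕ → ((ι → ℕ) → ℝ) → V → V → ℝ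
  | 0, φ => fun _ _ => φ 0
  | k + 1, φ => nbOp G b fun y z => visitExp G b v k (fun a => φ (a + hitVector v z)) y z

variable {G : SimpleGraph V} [DecidableRel G.Adj] {b : ℝ} {v : ι → V}

lemma visitExp_add (k : ℕ) (φ ψ : (ι → ℕ) → ℝ) :
    visitExp G b v k (fun a => φ a + ψ a) = visitExp G b v k φ + visitExp G b v k ψ := by
  induction k generalizing φ ψ with
  | zero => rfl
  | succ k ih =>
    simp only [visitExp, ih]
    rw [← map_add]
    rfl

lemma visitExp_const_mul (k : ℕ) (c : ℝ) (φ : (ι → ℕ) → ℝ) :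
    visitExp G b v k (fun a => c * φ a) = c • visitExp G b v k φ := by
  induction k generalizing φ with
  | zero => rfl
  | succ k ih =>
    simp only [visitExp, ih]
    rw [← map_smul]
    rfl

lemma visitExp_sum {κ : Type*} (k : ℕ) (A : Finset κ) (φ : κ → (ι → ℕ) → ℝ) :
    visitExp G b v k (fun a => ∑ i ∈ A, φ i a) = ∑ i ∈ A, visitExp G b v k (φ i) := by
  classical
  induction A using Finset.induction_on with
  | empty => simpa using visitExp_const_mul (G := G) (b := b) (v := v) k 0 0
  | insert i A hi ih =>
    simp only [sum_insert hi]
    rw [visitExp_add, ih]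

lemma visitExp_nonneg (hb : 0 ≤ b) (k : ℕ) {φ : (ι → ℕ) → ℝ} (hφ : ∀ a, 0 ≤ φ a) (x y : V) :
    0 ≤ visitExp G b v k φ x y := by
  induction k generalizing φ x y with
  | zero => exact hφ 0
  | succ k ih => exact div_nonneg (sum_nonneg fun z _ => ih (fun a => hφ _) _ _) hb

lemma visitExp_one {d : ℕ} (hG : G.IsRegularOfDegree d) (hd : (d : ℝ) - 1 ≠ 0) (k : ℕ)
    {x y : V} (hxy : G.Adj x y) : visitExp G ((d : ℝ) - 1) v k (fun _ => 1) x y = 1 := by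
  induction k generalizing x y with
  | zero => rfl
  | succ k ih =>
    rw [visitExp, nbOp_congr (fun x y hxy => ih hxy)]
    simpa using nbOp_pow_one hG hd 1 1 hxy

variable [Fintype ι]

/-- The product of the binomial coefficients of `a` over `s`. -/
def chooseProd (s a : ι → ℕ) : ℝ := ∏ i, ((a i).choose (s i) : ℝ)

lemma chooseProd_nonneg (s a : ι → ℕ) : 0 ≤ chooseProd s a :=
  prod_nonneg fun _ _ => Nat.cast_nonneg _

lemma chooseProd_zero_left : chooseProd (0 : ι → ℕ) = fun _ => 1 := by
  ext a
  simp [chooseProd]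

lemma chooseProd_zero_right {s : ι → ℕ} (hs : s ≠ 0) : chooseProd s 0 = 0 := by
  obtain ⟨i, hi⟩ := Function.ne_iff.1 hs
  exact prod_eq_zero (mem_univ i) (by
    obtain ⟨k, hk⟩ := Nat.exists_eq_succ_of_ne_zero hi
    simp [hk])

/-- Pascal's rule: by injectivity a step changes at most one coordinate. Indices with `s i = 0` must
be left out because subtraction is truncated. -/
lemma chooseProd_add_hitVector {V : Type*} [DecidableEq V] [DecidableEq ι] {v : ι → V} (hv : Function.Injective v) (s a : ι → ℕ) (z : V) :
    chooseProd s (a + hitVector v z) = chooseProd s a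
      + ∑ i with s i ≠ 0, (if z = v i then 1 else 0) * chooseProd (s - Pi.single i 1) a := by
  by_cases hz : ∃ i, z = v i
  · obtain ⟨i, rfl⟩ := hz
    have hother : ∀ j ∈ univ.erase i, (a + hitVector v (v i)) j = a j := by
      intro j hj
      have : v i ≠ v j := fun h => (ne_of_mem_erase hj) (hv h).symm
      simp [hitVector, this]
    have hself : (a + hitVector v (v i)) i = a i + 1 := by simp [hitVector]
    have hsum : ∑ j with s j ≠ 0, (if v i = v j then (1 : ℝ) else 0)
          * chooseProd (s - Pi.single j 1) a
        = if s i ≠ 0 then chooseProd (s - Pi.single i 1) a else 0 := by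
      rw [sum_filter, sum_eq_single i]
      · simp
      · intro j _ hj
        have : v i ≠ v j := fun h => hj (hv h).symm
        simp [this]
      · simp
    rw [hsum]
    unfold chooseProd
    rw [← mul_prod_erase univ (fun j => (((a + hitVector v (v i)) j).choose (s j) : ℝ))
        (mem_univ i),
      ← mul_prod_erase univ (fun j => ((a j).choose (s j) : ℝ)) (mem_univ i),
      prod_congr rfl fun j hj => by rw [hother j hj], hself]
    split_ifs with hs
    · have hu : ∀ j ∈ univ.erase i, (s - Pi.single i 1 : ι → ℕ) j = s j := fun j hj => by
        simp [(ne_of_mem_erase hj)]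
      obtain ⟨k, hk⟩ := Nat.exists_eq_succ_of_ne_zero hs
      have hui : (s - Pi.single i 1 : ι → ℕ) i = k := by simp [hk]
      generalize (s - Pi.single i 1 : ι → ℕ) = u at hu hui
      rw [← mul_prod_erase univ (fun j => ((a j).choose (u j) : ℝ)) (mem_univ i),
        prod_congr rfl fun j hj => by rw [← hu j hj], ← add_mul, hui, hk]
      congr 1
      rw [Nat.choose_succ_succ]
      push_cast
      ring
    · push Not at hs
      simp [hs]
  · push Not at hz
    have h0 : hitVector v z = 0 := by
      ext i
      simp [hitVector, hz i]
    simp [h0, hz]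

/-- The expected number of ways to choose `s i` visits to `v i` for each `i`, among the next `k`
steps of the walk. -/
noncomputable def visitMoment (G : SimpleGraph V) [DecidableRel G.Adj] (b : ℝ) (v : ι → V)
    (k : ℕ) (s : ι → ℕ) : V → V → ℝ :=
  visitExp G b v k (chooseProd s)

lemma visitMoment_nonneg (hb : 0 ≤ b) (k : ℕ) (s : ι → ℕ) (x y : V) :
    0 ≤ visitMoment G b v k s x y :=
  visitExp_nonneg hb k (chooseProd_nonneg s) x y

lemma visitMoment_succ [DecidableEq ι] (hv : Function.Injective v) (k : ℕ) (s : ι → ℕ) :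
    visitMoment G b v (k + 1) s = nbOp G b (visitMoment G b v k s
      + ∑ i with s i ≠ 0, fun y z =>
          (if z = v i then 1 else 0) * visitMoment G b v k (s - Pi.single i 1) y z) := by
  unfold visitMoment
  rw [visitExp]
  congr 1
  ext y z
  simp only [chooseProd_add_hitVector hv]
  rw [visitExp_add, visitExp_sum]
  simp only [Pi.add_apply, Finset.sum_apply]
  congr 1
  refine sum_congr rfl fun i _ => ?_
  rw [visitExp_const_mul]
  rfl

/-- Decomposition of the moments according to the first of the chosen visits. -/
lemma visitMoment_eq_sum [DecidableEq ι] (hv : Function.Injective v) (m : ℕ) {s : ι → ℕ} (hs : s ≠ 0) :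
    visitMoment G b v m s = ∑ j ∈ range m, ∑ i with s i ≠ 0, (nbOp G b ^ (j + 1)) fun y z =>
      (if z = v i then 1 else 0) * visitMoment G b v (m - 1 - j) (s - Pi.single i 1) y z := by
  induction m with
  | zero =>
    ext x y
    simp [visitMoment, visitExp, chooseProd_zero_right hs]
  | succ m ih =>
    rw [visitMoment_succ hv, map_add, ih, sum_range_succ', map_sum, map_sum]
    congr 1
    · refine sum_congr rfl fun j _ => ?_
      rw [map_sum]
      refine sum_congr rfl fun i _ => ?_
      rw [pow_succ' _ (j + 1), Module.End.mul_apply, Nat.sub_sub m 1 j, Nat.add_sub_cancel,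
        Nat.add_comm 1 j]

/-- Markov property at an arrival in `z`: the future `f` is replaced by its worst value over
incoming edges. -/
lemma nbOp_pow_indicator_mul_le (hb : 0 ≤ b) {k : ℕ} {z : V} {f : V → V → ℝ} {B : ℝ}
    (hf : ∀ x, G.Adj x z → f x z ≤ B) {x y : V} (hxy : G.Adj x y) :
    (nbOp G b ^ k) (fun y w => (if w = z then 1 else 0) * f y w) x y
      ≤ (nbOp G b ^ k) (fun _ y => if y = z then 1 else 0) x y * B := by
  have h := nbOp_pow_mono (G := G) hb (f := fun y w => (if w = z then 1 else 0) * f y w)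
    (g := B • fun _ w => if w = z then 1 else 0) (fun x y hxy => by
      by_cases hy : y = z
      · subst hy
        simpa using hf x hxy
      · simp [hy]) k hxy
  rw [map_smul] at h
  simpa [mul_comm] using h

lemma le_nbOp_pow_indicator_mul (hb : 0 ≤ b) {k : ℕ} {z : V} {f : V → V → ℝ} {B : ℝ}
    (hf : ∀ x, G.Adj x z → B ≤ f x z) {x y : V} (hxy : G.Adj x y) :
    (nbOp G b ^ k) (fun _ y => if y = z then 1 else 0) x y * B
      ≤ (nbOp G b ^ k) (fun y w => (if w = z then 1 else 0) * f y w) x y := by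
  have h := nbOp_pow_mono (G := G) hb (g := fun y w => (if w = z then 1 else 0) * f y w)
    (f := B • fun _ w => if w = z then 1 else 0) (fun x y hxy => by
      by_cases hy : y = z
      · subst hy
        simpa using hf x hxy
      · simp [hy]) k hxy
  rw [map_smul] at h
  simpa [mul_comm] using h

end VisitExpectation

/-! ### Discrete forms of the integral of a power. -/

lemma pow_succ_add_le_add_pow {A h : ℝ} (hA : 0 ≤ A) (hh : 0 ≤ h) (K : ℕ) :
    A ^ (K + 1) + (K + 1) * h * A ^ K ≤ (A + h) ^ (K + 1) := by
  induction K with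
  | zero => simp
  | succ K ih =>
    have h1 : 0 ≤ (K + 1) * h ^ 2 * A ^ K := by positivity
    calc A ^ (K + 1 + 1) + ((K + 1 : ℕ) + 1) * h * A ^ (K + 1)
        ≤ (A ^ (K + 1) + (K + 1) * h * A ^ K) * (A + h) := by push_cast; ring_nf at h1 ⊢; linarith
      _ ≤ (A + h) ^ (K + 1) * (A + h) := by gcongr
      _ = (A + h) ^ (K + 1 + 1) := by ring

lemma sum_range_mul_pow_le {p B : ℝ} (hp : 0 ≤ p) (hB : 0 ≤ B) (K m : ℕ) :
    (K + 1) * ∑ j ∈ range m, p * (((m - 1 - j : ℕ) : ℝ) * p + B) ^ K ≤ (m * p + B) ^ (K + 1) := by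
  rw [sum_range_reflect (fun i => p * ((i : ℝ) * p + B) ^ K) m]
  induction m with
  | zero => simp; positivity
  | succ m ih =>
    rw [sum_range_succ, mul_add]
    have h := pow_succ_add_le_add_pow (A := m * p + B) (by positivity) hp K
    have e : ((m + 1 : ℕ) : ℝ) * p + B = m * p + B + p := by push_cast; ring
    rw [e]
    linarith

lemma sum_range_ite_lt_le {a : ℝ} (ha : 0 ≤ a) (m T : ℕ) :
    ∑ j ∈ range m, (if j + 1 < T then a else 0) ≤ T * a := by
  rw [← sum_filter, sum_const, nsmul_eq_mul]
  gcongr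
  calc #{j ∈ range m | j + 1 < T} ≤ #(range T) := card_le_card fun j hj => by
        simp only [mem_filter, mem_range] at hj ⊢; omega
    _ = T := card_range T

lemma sub_pow_le_sum_range (c K M : ℕ) :
    (M - 1 - c) ^ (K + 1) ≤ (K + 1) * ∑ i ∈ range M, (i - c) ^ K := by
  induction M with
  | zero => simp
  | succ M ih =>
    rw [sum_range_succ, mul_add]
    simp only [Nat.add_sub_cancel]
    rcases le_or_gt M c with h | h
    · simp [Nat.sub_eq_zero_of_le h]
    obtain ⟨l, rfl⟩ := Nat.exists_eq_add_of_lt h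
    have e1 : c + l + 1 - c = l + 1 := by omega
    have e2 : c + l + 1 - 1 - c = l := by omega
    rw [e2] at ih
    rw [e1]
    have key : (l + 1) ^ (K + 1) ≤ l ^ (K + 1) + (K + 1) * (l + 1) ^ K := by
      clear ih e1 e2 h
      induction K with
      | zero => simp
      | succ K ih =>
        calc (l + 1) ^ (K + 1 + 1) = (l + 1) ^ (K + 1) * l + (l + 1) ^ (K + 1) := by ring
          _ ≤ (l ^ (K + 1) + (K + 1) * (l + 1) ^ K) * l + (l + 1) ^ (K + 1) := by gcongr
          _ = l ^ (K + 1 + 1) + (K + 1) * ((l + 1) ^ K * l) + (l + 1) ^ (K + 1) := by ring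
          _ ≤ l ^ (K + 1 + 1) + (K + 1) * ((l + 1) ^ K * (l + 1)) + (l + 1) ^ (K + 1) := by
              gcongr; omega
          _ = _ := by ring
    omega

/-- Each of the `K + 1` chosen visits forfeits `T` steps; this is the induction step of
`le_visitMoment`. -/
lemma sub_mul_pow_le_sum_range {T : ℕ} (hT : 1 ≤ T) (K m : ℕ) :
    (m - (K + 1) * T) ^ (K + 1)
      ≤ (K + 1) * ∑ j ∈ range m, if T ≤ j + 1 then (m - 1 - j - K * T) ^ K else 0 := by
  have h := sub_pow_le_sum_range (K * T) K (m + 1 - T)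
  have e : m + 1 - T - 1 - K * T = m - (K + 1) * T := by
    rw [add_mul, one_mul]; omega
  rw [e] at h
  refine h.trans (Nat.mul_le_mul_left _ ?_)
  have r := sum_range_reflect (fun i => if T ≤ m - i then (i - K * T) ^ K else 0) m
  have r' : ∑ j ∈ range m, (if T ≤ j + 1 then (m - 1 - j - K * T) ^ K else 0)
      = ∑ i ∈ range m, if T ≤ m - i then (i - K * T) ^ K else 0 := by
    rw [← r]
    refine sum_congr rfl fun j hj => ?_
    have : m - (m - 1 - j) = j + 1 := by have := mem_range.1 hj; omega
    rw [this]
  rw [r', ← sum_filter]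
  refine (sum_le_sum_of_subset fun i hi => ?_)
  simp only [mem_filter, mem_range] at hi ⊢
  omega

/-! ### Upper and lower bounds for the moments. -/

section MomentBounds

variable {V : Type*} [Fintype V] [DecidableEq V] {ι : Type*} [Fintype ι]
  {G : SimpleGraph V} [DecidableRel G.Adj] {v : ι → V}

lemma prod_factorial_sub_single [DecidableEq ι] {s : ι → ℕ} {i : ι} (hi : s i ≠ 0) :
    (∏ j, ((s j).factorial : ℝ)) = s i * ∏ j, (((s - Pi.single i 1 : ι → ℕ) j).factorial : ℝ) := by
  have hu : ∀ j ∈ univ.erase i, (s - Pi.single i 1 : ι → ℕ) j = s j := fun j hj => by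
    simp [(ne_of_mem_erase hj)]
  obtain ⟨k, hk⟩ := Nat.exists_eq_succ_of_ne_zero hi
  have hui : (s - Pi.single i 1 : ι → ℕ) i = k := by simp [hk]
  generalize (s - Pi.single i 1 : ι → ℕ) = u at hu hui
  rw [← mul_prod_erase univ (fun j => ((s j).factorial : ℝ)) (mem_univ i),
    ← mul_prod_erase univ (fun j => ((u j).factorial : ℝ)) (mem_univ i),
    prod_congr rfl fun j hj => by rw [← hu j hj], ← mul_assoc, hui, hk, Nat.factorial_succ,
    Nat.cast_mul]

lemma sum_sub_single [DecidableEq ι] {s : ι → ℕ} {i : ι} (hi : s i ≠ 0) {K : ℕ} (hK : ∑ j, s j = K + 1) :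
    ∑ j, (s - Pi.single i 1 : ι → ℕ) j = K := by
  rw [← add_sum_erase univ _ (mem_univ i)] at hK ⊢
  have : ∑ j ∈ univ.erase i, (s - Pi.single i 1 : ι → ℕ) j = ∑ j ∈ univ.erase i, s j :=
    sum_congr rfl fun j hj => by simp [(ne_of_mem_erase hj)]
  rw [this]
  simp only [Pi.sub_apply, Pi.single_eq_same]
  omega

lemma sum_inv_prod_factorial [DecidableEq ι] {s : ι → ℕ} {K : ℕ} (hK : ∑ j, s j = K) :
    ∑ i with s i ≠ 0, (∏ j, (((s - Pi.single i 1 : ι → ℕ) j).factorial : ℝ))⁻¹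
      = K * (∏ j, ((s j).factorial : ℝ))⁻¹ := by
  have h : ∀ i ∈ univ.filter (fun i => s i ≠ 0),
      (∏ j, (((s - Pi.single i 1 : ι → ℕ) j).factorial : ℝ))⁻¹
        = (s i : ℝ) * (∏ j, ((s j).factorial : ℝ))⁻¹ := by
    intro i hi
    have hi' := (mem_filter.1 hi).2
    rw [prod_factorial_sub_single hi', mul_inv]
    have : (s i : ℝ) ≠ 0 := by exact_mod_cast hi'
    field_simp
  rw [sum_congr rfl h, ← sum_mul, ← hK]
  congr 1
  rw [sum_filter]
  push_cast
  exact sum_congr rfl fun i _ => by by_cases h : s i = 0 <;> simp [h]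

/-- Induction on the order, conditioning on the first chosen visit; the walk then stands at some `v
i`, so `hgood` is inherited. The `p` part sums to at most `R ^ (K + 1)`, the early part has mass at
most `η`, and both fit into `(R + η) ^ (K + 1)`. -/
lemma visitMoment_le {d : ℕ} (hG : G.IsRegularOfDegree d) (hd : 2 ≤ d)
    (hv : Function.Injective v) {p a η : ℝ} {T : ℕ} (hp : 0 ≤ p) (ha : 0 ≤ a) (hη : T * a ≤ η)
    (hhit : ∀ (i : ι) (j : ℕ) (x y : V), G.Adj x y → ((∃ l, x = v l) ∨ ∃ l, y = v l) → 1 ≤ j →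
      (nbOp G ((d : ℝ) - 1) ^ j) (fun _ y => if y = v i then 1 else 0) x y
        ≤ p + if j < T then a else 0)
    (K : ℕ) (s : ι → ℕ) (hs : ∑ i, s i = K) (m : ℕ) (x y : V) (hxy : G.Adj x y)
    (hgood : (∃ l, x = v l) ∨ ∃ l, y = v l) :
    visitMoment G ((d : ℝ) - 1) v m s x y
      ≤ (m * p + K * η) ^ K * (∏ i, ((s i).factorial : ℝ))⁻¹ := by
  have hd' : (2 : ℝ) ≤ d := by exact_mod_cast hd
  have hb : (0 : ℝ) < d - 1 := by linarith
  classical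
  have hη0 : 0 ≤ η := le_trans (by positivity) hη
  induction K generalizing s m x y with
  | zero =>
    have h0 : s = 0 := by
      ext i
      exact (sum_eq_zero_iff.1 hs) i (mem_univ i)
    rw [visitMoment, h0, chooseProd_zero_left, visitExp_one hG hb.ne' m hxy]
    simp
  | succ K ih =>
    have hs0 : s ≠ 0 := by
      rintro rfl
      simp at hs
    set F : ℝ := (∏ i, ((s i).factorial : ℝ))⁻¹ with hF
    have hF0 : 0 ≤ F := by positivity
    rw [visitMoment_eq_sum hv m hs0]
    simp only [Finset.sum_apply]
    set Q : ℕ → ℝ := fun j => (((m - 1 - j : ℕ) : ℝ) * p + K * η) ^ K with hQ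
    have hQ0 : ∀ j, 0 ≤ Q j := fun j => by positivity
    have hterm : ∀ j ∈ range m, ∑ i with s i ≠ 0, (nbOp G ((d : ℝ) - 1) ^ (j + 1)) (fun y z =>
        (if z = v i then 1 else 0)
          * visitMoment G ((d : ℝ) - 1) v (m - 1 - j) (s - Pi.single i 1) y z) x y
        ≤ (p + if j + 1 < T then a else 0) * (Q j * ((K + 1) * F)) := by
      intro j _
      have e : ((K : ℝ) + 1) * F
          = ∑ i with s i ≠ 0, (∏ j, (((s - Pi.single i 1 : ι → ℕ) j).factorial : ℝ))⁻¹ := by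
        rw [sum_inv_prod_factorial hs]
        push_cast
        rfl
      rw [e, mul_sum, mul_sum]
      refine sum_le_sum fun i hi => ?_
      have hi' := (mem_filter.1 hi).2
      refine (nbOp_pow_indicator_mul_le hb.le (B := Q j *
        (∏ j, (((s - Pi.single i 1 : ι → ℕ) j).factorial : ℝ))⁻¹) (fun x' hx' => ?_) hxy).trans ?_
      · exact ih _ (sum_sub_single hi' hs) _ _ _ hx' (Or.inr ⟨i, rfl⟩)
      · refine mul_le_mul_of_nonneg_right (hhit i (j + 1) x y hxy hgood (by omega)) ?_
        have := hQ0 j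
        positivity
    refine (sum_le_sum hterm).trans ?_
    set R : ℝ := m * p + K * η with hR
    have hR0 : 0 ≤ R := by positivity
    have hQR : ∀ j, Q j ≤ R ^ K := by
      intro j
      simp only [hQ, hR]
      gcongr
      omega
    calc ∑ j ∈ range m, (p + if j + 1 < T then a else 0) * (Q j * ((K + 1) * F))
        = (K + 1) * F * (∑ j ∈ range m, p * Q j)
            + (K + 1) * F * ∑ j ∈ range m, (if j + 1 < T then a else 0) * Q j := by
          rw [mul_sum, mul_sum, ← sum_add_distrib]
          exact sum_congr rfl fun j _ => by ring
      _ ≤ (K + 1) * F * (∑ j ∈ range m, p * Q j)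
            + (K + 1) * F * ∑ j ∈ range m, (if j + 1 < T then a else 0) * R ^ K := by
          gcongr with j hj
          exact hQR j
      _ ≤ (K + 1) * F * (∑ j ∈ range m, p * Q j) + (K + 1) * F * (η * R ^ K) := by
          rw [← sum_mul]
          gcongr
          exact (sum_range_ite_lt_le ha m T).trans hη
      _ = F * ((K + 1) * (∑ j ∈ range m, p * Q j) + (K + 1) * η * R ^ K) := by ring
      _ ≤ F * (R ^ (K + 1) + (K + 1) * η * R ^ K) := by
          gcongr
          exact sum_range_mul_pow_le hp (by positivity) K m
      _ ≤ F * (R + η) ^ (K + 1) := by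
          gcongr
          exact pow_succ_add_le_add_pow hR0 hη0 K
      _ = (m * p + (K + 1 : ℕ) * η) ^ (K + 1) * F := by
          rw [hR]; push_cast; ring

/-- Only choices whose consecutive gaps are at least `T` are kept; the discarded ones contribute
nonnegatively. -/
lemma le_visitMoment {d : ℕ} (hG : G.IsRegularOfDegree d) (hd : 2 ≤ d)
    (hv : Function.Injective v) {q : ℝ} {T : ℕ} (hq : 0 ≤ q) (hT : 1 ≤ T)
    (hhit : ∀ (i : ι) (j : ℕ) (x y : V), G.Adj x y → T ≤ j →
      q ≤ (nbOp G ((d : ℝ) - 1) ^ j) (fun _ y => if y = v i then 1 else 0) x y)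
    (K : ℕ) (s : ι → ℕ) (hs : ∑ i, s i = K) (m : ℕ) (x y : V) (hxy : G.Adj x y) :
    (q * (m - K * T : ℕ)) ^ K * (∏ i, ((s i).factorial : ℝ))⁻¹
      ≤ visitMoment G ((d : ℝ) - 1) v m s x y := by
  have hd' : (2 : ℝ) ≤ d := by exact_mod_cast hd
  have hb : (0 : ℝ) < d - 1 := by linarith
  classical
  induction K generalizing s m x y with
  | zero =>
    have h0 : s = 0 := by
      ext i
      exact (sum_eq_zero_iff.1 hs) i (mem_univ i)
    rw [visitMoment, h0, chooseProd_zero_left, visitExp_one hG hb.ne' m hxy]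
    simp
  | succ K ih =>
    have hs0 : s ≠ 0 := by
      rintro rfl
      simp at hs
    set F : ℝ := (∏ i, ((s i).factorial : ℝ))⁻¹ with hF
    have hF0 : 0 ≤ F := by positivity
    rw [visitMoment_eq_sum hv m hs0]
    simp only [Finset.sum_apply]
    set Q : ℕ → ℝ := fun j => (q * (m - 1 - j - K * T : ℕ)) ^ K with hQ
    have hQ0 : ∀ j, 0 ≤ Q j := fun j => by positivity
    have hterm : ∀ j ∈ range m, (if T ≤ j + 1 then q * (Q j * ((K + 1) * F)) else 0)
        ≤ ∑ i with s i ≠ 0, (nbOp G ((d : ℝ) - 1) ^ (j + 1)) (fun y z =>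
        (if z = v i then 1 else 0)
          * visitMoment G ((d : ℝ) - 1) v (m - 1 - j) (s - Pi.single i 1) y z) x y := by
      intro j _
      have e : ((K : ℝ) + 1) * F
          = ∑ i with s i ≠ 0, (∏ j, (((s - Pi.single i 1 : ι → ℕ) j).factorial : ℝ))⁻¹ := by
        rw [sum_inv_prod_factorial hs]
        push_cast
        rfl
      rw [e, mul_sum, mul_sum]
      split_ifs with hj
      · refine sum_le_sum fun i hi => ?_
        have hi' := (mem_filter.1 hi).2
        refine le_trans ?_ (le_nbOp_pow_indicator_mul hb.le (B := Q j *
          (∏ j, (((s - Pi.single i 1 : ι → ℕ) j).factorial : ℝ))⁻¹) (fun x' hx' => ?_) hxy)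
        · refine mul_le_mul_of_nonneg_right (hhit i (j + 1) x y hxy hj) ?_
          have := hQ0 j
          positivity
        · exact ih _ (sum_sub_single hi' hs) _ _ _ hx'
      · refine sum_nonneg fun i _ => ?_
        have h := le_nbOp_pow_indicator_mul (G := G) hb.le (k := j + 1) (z := v i) (B := 0)
          (f := fun y z => visitMoment G ((d : ℝ) - 1) v (m - 1 - j) (s - Pi.single i 1) y z)
          (fun x' _ => visitMoment_nonneg hb.le _ _ _ _) hxy
        simpa using h
    refine le_trans ?_ (sum_le_sum hterm)
    have hc : (((m - (K + 1) * T : ℕ) : ℝ)) ^ (K + 1) ≤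
        ((K : ℝ) + 1) * ∑ j ∈ range m, if T ≤ j + 1 then ((m - 1 - j - K * T : ℕ) : ℝ) ^ K else 0 := by
      have h := sub_mul_pow_le_sum_range hT K m
      have h' : (((m - (K + 1) * T) ^ (K + 1) : ℕ) : ℝ) ≤ ((K + 1) * ∑ j ∈ range m,
        if T ≤ j + 1 then (m - 1 - j - K * T) ^ K else 0 : ℕ) := Nat.cast_le.2 h
      rw [Nat.cast_pow, Nat.cast_mul, Nat.cast_sum, Nat.cast_add_one] at h'
      refine h'.trans_eq ?_
      congr 1
      refine sum_congr rfl fun j _ => ?_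
      split_ifs
      · rw [Nat.cast_pow]
      · rw [Nat.cast_zero]
    calc (q * (m - (K + 1) * T : ℕ)) ^ (K + 1) * F
        = q ^ (K + 1) * F * ((m - (K + 1) * T : ℕ) : ℝ) ^ (K + 1) := by rw [mul_pow]; ring
      _ ≤ q ^ (K + 1) * F * (((K : ℝ) + 1) * ∑ j ∈ range m,
            if T ≤ j + 1 then ((m - 1 - j - K * T : ℕ) : ℝ) ^ K else 0) := by gcongr
      _ = ∑ j ∈ range m, if T ≤ j + 1 then q * (Q j * ((K + 1) * F)) else 0 := by
          rw [mul_sum, mul_sum]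
          refine sum_congr rfl fun j _ => ?_
          split_ifs
          · simp only [hQ, mul_pow]; ring
          · simp

end MomentBounds

/-! ### Finite expectations. -/

/-- The expectation of a real function under a probability mass function on a finite type. -/
noncomputable def PMF.expect {α : Type*} [Fintype α] (p : PMF α) (f : α → ℝ) : ℝ :=
  ∑ a, (p a).toReal * f a

namespace PMF

variable {α β : Type*} [Fintype α] [Fintype β]

lemma expect_congr {p : PMF α} {f g : α → ℝ} (h : ∀ a, p a ≠ 0 → f a = g a) :
    p.expect f = p.expect g := by
  refine sum_congr rfl fun a _ => ?_
  by_cases ha : p a = 0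
  · simp [ha]
  · rw [h a ha]

lemma expect_pure (a : α) (f : α → ℝ) : (PMF.pure a).expect f = f a := by
  classical
  unfold expect
  rw [sum_eq_single a]
  · simp [PMF.pure_apply]
  · intro b _ hb
    simp [PMF.pure_apply, hb]
  · simp

lemma expect_bind (p : PMF α) (q : α → PMF β) (f : β → ℝ) :
    (p.bind q).expect f = p.expect fun a => (q a).expect f := by
  unfold expect
  simp_rw [PMF.bind_apply, tsum_fintype, mul_sum]
  rw [sum_comm]
  refine sum_congr rfl fun b _ => ?_
  rw [ENNReal.toReal_sum fun a _ => ENNReal.mul_ne_top (p.apply_ne_top a) ((q a).apply_ne_top b),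
    sum_mul]
  exact sum_congr rfl fun a _ => by rw [ENNReal.toReal_mul]; ring

lemma expect_map (p : PMF α) (g : α → β) (f : β → ℝ) :
    (p.map g).expect f = p.expect fun a => f (g a) := by
  rw [PMF.map, expect_bind]
  exact expect_congr fun a _ => expect_pure _ _

lemma expect_uniformOfFinset (s : Finset α) (hs : s.Nonempty) (f : α → ℝ) :
    (PMF.uniformOfFinset s hs).expect f = (∑ a ∈ s, f a) / #s := by
  classical
  unfold expect
  rw [sum_div, ← sum_filter_add_sum_filter_not univ (· ∈ s), filter_mem_eq_inter, univ_inter,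
    sum_eq_zero (s := univ.filter (· ∉ s)), add_zero]
  · refine sum_congr rfl fun a ha => ?_
    simp [PMF.uniformOfFinset_apply, ha]
    ring
  · intro a ha
    simp [PMF.uniformOfFinset_apply, (mem_filter.1 ha).2]

lemma expect_sum {κ : Type*} (p : PMF α) (A : Finset κ) (f : κ → α → ℝ) :
    (p.expect fun a => ∑ i ∈ A, f i a) = ∑ i ∈ A, p.expect (f i) := by
  unfold expect
  simp_rw [mul_sum]
  rw [sum_comm]

lemma expect_const_mul (p : PMF α) (c : ℝ) (f : α → ℝ) :
    (p.expect fun a => c * f a) = c * p.expect f := by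
  unfold expect
  rw [mul_sum]
  exact sum_congr rfl fun a _ => by ring

open Classical in
lemma toReal_toOuterMeasure (p : PMF α) (s : Set α) :
    (p.toOuterMeasure s).toReal = p.expect fun a => if a ∈ s then 1 else 0 := by
  rw [PMF.toOuterMeasure_apply, tsum_fintype, ENNReal.toReal_sum]
  · refine sum_congr rfl fun a _ => ?_
    by_cases ha : a ∈ s <;> simp [ha]
  · intro a _
    by_cases ha : a ∈ s <;> simp [ha, p.apply_ne_top a]

end PMF

/-! ### From the law of the walk to the transfer operator. -/

section WalkLaw

variable {V : Type*} [Fintype V] [DecidableEq V] {G : SimpleGraph V} [DecidableRel G.Adj]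

lemma visits_snoc {V : Type*} [DecidableEq V] {m : ℕ} (w : Fin (m + 1) → V) (x y : V) :
    visits (Fin.snoc w x : Fin (m + 2) → V) y = visits w y + if x = y then 1 else 0 := by
  unfold visits
  rw [card_filter, card_filter, Fin.sum_univ_castSucc]
  congr 1
  · refine sum_congr rfl fun j _ => ?_
    rw [Fin.succ_castSucc, Fin.snoc_castSucc]
  · rw [Fin.succ_last, Fin.snoc_last]

lemma nbCandidates_zero (w : Fin 1 → V) : nbCandidates G w = G.neighborFinset (w 0) := by
  ext x
  simp [nbCandidates]

lemma nbCandidates_succ {k : ℕ} (w : Fin (k + 2) → V) :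
    nbCandidates G w
      = ({x | G.Adj (w (Fin.last (k + 1))) x ∧ x ≠ w (Fin.last k).castSucc} : Finset V) := by
  ext x
  simp only [nbCandidates, mem_filter, mem_univ, true_and]
  refine and_congr_right fun _ => ⟨fun h => h _ (by simp), fun h j hj => ?_⟩
  have : j = (Fin.last k).castSucc := by
    ext
    simp only [Fin.val_castSucc, Fin.val_last]
    omega
  rwa [this]

lemma expect_nbStep {k : ℕ} (w : Fin (k + 1) → V) (h : (nbCandidates G w).Nonempty)
    (f : V → ℝ) :
    (nbStep G w).expect f = (∑ x ∈ nbCandidates G w, f x) / #(nbCandidates G w) := by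
  rw [nbStep, dif_pos h, PMF.expect_uniformOfFinset]

lemma expect_nbWalk_succ (u : V) (m : ℕ) (f : (Fin (m + 2) → V) → ℝ) :
    (nbWalk G u (m + 1)).expect f = (nbWalk G u m).expect fun w =>
      (nbStep G w).expect fun x => f (Fin.snoc w x : Fin (m + 2) → V) := by
  rw [nbWalk, PMF.expect_bind]
  exact PMF.expect_congr fun w _ => PMF.expect_map _ _ _

lemma nbCandidates_nonempty_of_adj {d : ℕ} (hG : G.IsRegularOfDegree d) (hd : 2 ≤ d) {k : ℕ}
    {w : Fin (k + 2) → V} (h : G.Adj (w (Fin.last k).castSucc) (w (Fin.last (k + 1)))) :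
    (nbCandidates G w).Nonempty := by
  rw [← card_pos, nbCandidates_succ]
  have h1 := card_filter_adj_ne hG h
  have hd' : (2 : ℝ) ≤ d := by exact_mod_cast hd
  have h2 : (0 : ℝ) < #{z | G.Adj (w (Fin.last (k + 1))) z ∧ z ≠ w (Fin.last k).castSucc} := by
    rw [h1]; linarith
  exact_mod_cast h2

lemma nbCandidates_nonempty_zero {d : ℕ} (hG : G.IsRegularOfDegree d) (hd : 2 ≤ d)
    (w : Fin 1 → V) : (nbCandidates G w).Nonempty := by
  rw [nbCandidates_zero, ← card_pos, G.card_neighborFinset_eq_degree, hG]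
  omega

lemma adj_of_nbWalk_ne_zero {d : ℕ} (hG : G.IsRegularOfDegree d) (hd : 2 ≤ d) (u : V) (k : ℕ)
    {w : Fin (k + 2) → V} (hw : nbWalk G u (k + 1) w ≠ 0) :
    G.Adj (w (Fin.last k).castSucc) (w (Fin.last (k + 1))) := by
  induction k with
  | zero =>
    rw [nbWalk, ← PMF.mem_support_iff, PMF.mem_support_bind_iff] at hw
    obtain ⟨w', -, hw⟩ := hw
    obtain ⟨x, hx, rfl⟩ := (PMF.mem_support_map_iff _ _ _).1 hw
    have hne := nbCandidates_nonempty_zero hG hd w'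
    rw [nbStep, dif_pos hne, PMF.mem_support_uniformOfFinset_iff] at hx
    rw [Fin.snoc_castSucc, Fin.snoc_last]
    exact (mem_filter.1 hx).2.1
  | succ k ih =>
    rw [nbWalk, ← PMF.mem_support_iff, PMF.mem_support_bind_iff] at hw
    obtain ⟨w', hw', hw⟩ := hw
    obtain ⟨x, hx, rfl⟩ := (PMF.mem_support_map_iff _ _ _).1 hw
    have hne := nbCandidates_nonempty_of_adj hG hd (ih hw')
    rw [nbStep, dif_pos hne, PMF.mem_support_uniformOfFinset_iff] at hx
    rw [Fin.snoc_castSucc, Fin.snoc_last]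
    exact (mem_filter.1 hx).2.1

variable {ι : Type*}

lemma visits_snoc_eq_add_hitVector {V : Type*} [DecidableEq V] {m : ℕ} (v : ι → V) (w : Fin (m + 1) → V) (x : V) :
    (fun i => visits (Fin.snoc w x : Fin (m + 2) → V) (v i))
      = (fun i => visits w (v i)) + hitVector v x := by
  ext i
  rw [visits_snoc]
  rfl

/-- The last `k` steps depend on the past only through its last edge. At least one step must be
revealed for that edge to exist. -/
lemma expect_nbWalk_visits_eq {d : ℕ} (hG : G.IsRegularOfDegree d) (hd : 2 ≤ d) (u : V)
    (v : ι → V) (φ : (ι → ℕ) → ℝ) (k l m : ℕ) (hm : m = l + 1 + k) :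
    ((nbWalk G u m).expect fun w => φ fun i => visits w (v i))
      = (nbWalk G u (l + 1)).expect fun w =>
        visitExp G ((d : ℝ) - 1) v k (fun a => φ ((fun i => visits w (v i)) + a))
          (w (Fin.last l).castSucc) (w (Fin.last (l + 1))) := by
  induction k generalizing l with
  | zero =>
    subst hm
    simp [visitExp]
  | succ k ih =>
    rw [ih (l + 1) (by omega), expect_nbWalk_succ]
    refine PMF.expect_congr fun w hw => ?_
    have hadj := adj_of_nbWalk_ne_zero hG hd u l hw
    rw [expect_nbStep w (nbCandidates_nonempty_of_adj hG hd hadj), nbCandidates_succ,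
      card_filter_adj_ne hG hadj, visitExp, nbOp_apply]
    congr 1
    refine sum_congr rfl fun x _ => ?_
    rw [Fin.snoc_castSucc, Fin.snoc_last, visits_snoc_eq_add_hitVector]
    congr 1
    ext a
    rw [add_assoc, add_comm a]

/-- The expectation of a function of the visits of the non-backtracking walk, from the expectation
given the first step. -/
lemma expect_nbWalk_visits {d : ℕ} (hG : G.IsRegularOfDegree d) (hd : 2 ≤ d) (u : V)
    (v : ι → V) (hu : ∀ z, G.Adj u z → ∀ i, z ≠ v i) (φ : (ι → ℕ) → ℝ) (k : ℕ) :
    ((nbWalk G u (k + 1)).expect fun w => φ fun i => visits w (v i))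
      = (∑ z ∈ G.neighborFinset u, visitExp G ((d : ℝ) - 1) v k φ u z) / d := by
  rw [expect_nbWalk_visits_eq hG hd u v φ k 0 (k + 1) (by omega), expect_nbWalk_succ, nbWalk,
    PMF.expect_pure, expect_nbStep _ (nbCandidates_nonempty_zero hG hd _), nbCandidates_zero,
    G.card_neighborFinset_eq_degree, hG]
  congr 1
  refine sum_congr rfl fun z hz => ?_
  rw [Fin.snoc_castSucc, Fin.snoc_last, visits_snoc_eq_add_hitVector]
  congr 1
  ext a
  congr 1
  ext i
  have := hu z ((G.mem_neighborFinset _ _).1 hz) i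
  simp [hitVector, visits, this]

end WalkLaw

/-! ### Inclusion-exclusion: from binomial moments to point probabilities. -/

lemma ite_eq_alternating_sum {a t N : ℕ} (ha : a ≤ N) :
    (if a = t then (1 : ℝ) else 0)
      = ∑ j ∈ range (N + 1), (-1 : ℝ) ^ j * (t + j).choose t * a.choose (t + j) := by
  -- The sum becomes `a.choose t` times the expansion of `(1 - 1) ^ (a - t)`. Terms beyond `a`
  -- vanish, so `N` is free and can later tend to infinity.
  have h1 : ∀ j, ((-1 : ℝ)) ^ j * (t + j).choose t * a.choose (t + j)
      = a.choose t * ((-1) ^ j * (a - t).choose j) := by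
    intro j
    have h := Nat.choose_mul (n := a) (k := t + j) (s := t) (by omega)
    rw [Nat.add_sub_cancel_left] at h
    have h' : (a.choose (t + j) : ℝ) * (t + j).choose t = a.choose t * (a - t).choose j := by
      exact_mod_cast h
    linear_combination (-1 : ℝ) ^ j * h'
  rw [sum_congr rfl fun j _ => h1 j, ← mul_sum]
  rcases lt_or_ge a t with hat | hat
  · rw [Nat.choose_eq_zero_of_lt hat, if_neg hat.ne]
    simp
  have h2 : ∑ j ∈ range (N + 1), (-1 : ℝ) ^ j * (a - t).choose j
      = if a - t = 0 then 1 else 0 := by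
    have h := Int.alternating_sum_range_choose (n := a - t)
    have h' : ∑ j ∈ range (a - t + 1), (-1 : ℝ) ^ j * (a - t).choose j
        = if a - t = 0 then 1 else 0 := by
      exact_mod_cast congrArg (fun z : ℤ => (z : ℝ)) h
    rw [← h']
    symm
    refine sum_subset (fun j hj => ?_) fun j _ hj => ?_
    · simp only [mem_range] at hj ⊢; omega
    · rw [Nat.choose_eq_zero_of_lt (by simp only [mem_range] at hj; omega)]
      simp
  rw [h2]
  by_cases h : a = t
  · subst h; simp
  · have : a - t ≠ 0 := by omega
    simp [h, this]

lemma pow_div_factorial_le_exp {x : ℝ} (hx : 0 ≤ x) (k : ℕ) :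
    x ^ k / k.factorial ≤ Real.exp x := by
  refine le_trans ?_ (Real.sum_le_exp_of_nonneg hx (k + 1))
  exact single_le_sum (f := fun i => x ^ i / (i.factorial : ℝ)) (fun i _ => by positivity)
    (mem_range.2 (Nat.lt_succ_self k))

lemma prod_pow_div_factorial {ι : Type*} [Fintype ι] (x : ℝ) (j : ι → ℕ) :
    ∏ i, (x ^ j i / ((j i).factorial : ℝ)) = x ^ (∑ i, j i) * (∏ i, ((j i).factorial : ℝ))⁻¹ := by
  rw [prod_div_distrib, prod_pow_eq_pow_sum, div_eq_mul_inv]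

lemma one_add_mul_pow_le_exp {κ : ℝ} (hκ : 0 ≤ κ) {x : ℝ} (hx : 0 ≤ x) (n : ℕ) :
    (1 + x * κ) ^ n ≤ Real.exp (n * (x * κ)) := by
  rw [Real.exp_nat_mul]
  gcongr
  linarith [Real.add_one_le_exp (x * κ)]

section InclusionExclusion

variable {ι : Type*} [Fintype ι] [DecidableEq ι]

lemma ite_forall_eq_alternating_sum {a t : ι → ℕ} {N : ℕ} (ha : ∀ i, a i ≤ N) :
    (if ∀ i, a i = t i then (1 : ℝ) else 0)
      = ∑ j ∈ Fintype.piFinset fun _ => range (N + 1),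
          (∏ i, (-1) ^ j i * ((t i + j i).choose (t i) : ℝ)) * chooseProd (t + j) a := by
  have h : (if ∀ i, a i = t i then (1 : ℝ) else 0) = ∏ i, if a i = t i then (1 : ℝ) else 0 := by
    rw [prod_ite_zero]
    simp
  rw [h, prod_congr rfl fun i _ => ite_eq_alternating_sum (ha i), prod_univ_sum]
  refine sum_congr rfl fun j _ => ?_
  rw [chooseProd, ← prod_mul_distrib]
  rfl

lemma sum_piFinset_prod_pow_div_factorial_le {D : ℝ} (hD : 0 ≤ D) (N : ℕ) :
    ∑ j ∈ Fintype.piFinset fun _ : ι => range (N + 1), ∏ i, (D ^ j i / (j i).factorial)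
      ≤ Real.exp D ^ Fintype.card ι := by
  rw [← prod_univ_sum (fun _ : ι => range (N + 1)) fun _ k => D ^ k / (k.factorial : ℝ), prod_const,
    card_univ]
  gcongr
  exact Real.sum_le_exp_of_nonneg hD _

lemma sum_piFinset_geometric_le (N : ℕ) :
    ∑ j ∈ Fintype.piFinset fun _ : ι => range (N + 1), (1 / 4 : ℝ) ^ ∑ i, j i
      ≤ 2 ^ Fintype.card ι := by
  rw [sum_congr rfl fun j _ => (prod_pow_eq_pow_sum univ j (1 / 4 : ℝ)).symm,
    ← prod_univ_sum (fun _ : ι => range (N + 1)) fun _ k => (1 / 4 : ℝ) ^ k, prod_const, card_univ]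
  gcongr
  have h : ∑ k ∈ range (N + 1), (1 / 4 : ℝ) ^ k ≤ ∑' k : ℕ, (1 / 4 : ℝ) ^ k :=
    (summable_geometric_of_lt_one (by norm_num) (by norm_num)).sum_le_tsum _
      fun _ _ => by positivity
  rw [tsum_geometric_of_lt_one (by norm_num) (by norm_num)] at h
  linarith

/-- If the factorial moments are close to those of independent Poisson variables, then so are
the point probabilities. -/
lemma abs_div_prod_poisson_sub_one_le {μ D κ ε P : ℝ} (hμ : 0 < μ) (hD : 0 ≤ D) (hε : 0 ≤ ε)
    {M : (ι → ℕ) → ℝ} {t : ι → ℕ} {N₀ : ℕ}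
    (hP : ∀ N, N₀ ≤ N → P = ∑ j ∈ Fintype.piFinset fun _ => range (N + 1),
      (∏ i, (-1) ^ j i * ((t i + j i).choose (t i) : ℝ)) * M (t + j))
    (hM : ∀ s : ι → ℕ, |M s * (∏ i, ((s i).factorial : ℝ)) - μ ^ ∑ i, s i|
      ≤ μ ^ (∑ i, s i) * ((1 + (∑ i, s i : ℕ) * κ) ^ (∑ i, s i) - 1))
    (hpt : ∀ j : ι → ℕ, (∏ i, μ ^ j i / (j i).factorial)
        * ((1 + (∑ i, (t + j) i : ℕ) * κ) ^ (∑ i, (t + j) i) - 1)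
      ≤ ε * ((∏ i, D ^ j i / (j i).factorial) + (1 / 4) ^ ∑ i, j i)) :
    |P / (∏ i, (Real.exp (-μ) * μ ^ t i / (t i).factorial)) - 1|
      ≤ Real.exp μ ^ Fintype.card ι * (Real.exp D ^ Fintype.card ι + 2 ^ Fintype.card ι) * ε := by
  set r := Fintype.card ι with hr
  set W : ℝ := ∏ i, (μ ^ t i / (t i).factorial) with hW
  have hW0 : 0 < W := prod_pos fun i _ => by positivity
  have hPo : ∏ i, (Real.exp (-μ) * μ ^ t i / (t i).factorial) = Real.exp (-μ) ^ r * W := by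
    simp_rw [mul_div_assoc]
    rw [prod_mul_distrib, prod_const, card_univ]
  have hexp : Real.exp μ ^ r * Real.exp (-μ) ^ r = 1 := by
    rw [← mul_pow, ← Real.exp_add]
    simp
  have hdiv : P / (Real.exp (-μ) ^ r * W) = Real.exp μ ^ r * (P / W) := by
    have : Real.exp (-μ) ^ r ≠ 0 := by positivity
    field_simp
    linear_combination (-P) * hexp
  rw [hPo, hdiv]
  -- The comparison is with the truncated series of `exp (-μ)`, uniformly in `N`; as `N → ∞` the
  -- comparison term tends to 1.
  have hbound : ∀ N, N₀ ≤ N →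
      |Real.exp μ ^ r * (P / W)
          - Real.exp μ ^ r * (∑ k ∈ range (N + 1), (-μ) ^ k / (k.factorial : ℝ)) ^ r|
        ≤ Real.exp μ ^ r * (Real.exp D ^ r + 2 ^ r) * ε := by
    intro N hN
    have hA : (∑ k ∈ range (N + 1), (-μ) ^ k / (k.factorial : ℝ)) ^ r
        = ∑ j ∈ Fintype.piFinset fun _ : ι => range (N + 1),
            ∏ i, ((-μ) ^ j i / (j i).factorial) := by
      rw [← prod_univ_sum (fun _ : ι => range (N + 1)) fun _ k => (-μ) ^ k / (k.factorial : ℝ),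
        prod_const, card_univ]
    rw [← mul_sub, abs_mul, abs_of_pos (by positivity : 0 < Real.exp μ ^ r), mul_assoc, hA]
    gcongr
    rw [hP N hN, sum_div, ← sum_sub_distrib]
    calc |∑ j ∈ Fintype.piFinset fun _ : ι => range (N + 1),
          ((∏ i, (-1) ^ j i * ((t i + j i).choose (t i) : ℝ)) * M (t + j) / W
            - ∏ i, ((-μ) ^ j i / ((j i).factorial : ℝ)))|
        ≤ ∑ j ∈ Fintype.piFinset fun _ : ι => range (N + 1),
          ε * ((∏ i, D ^ j i / ((j i).factorial : ℝ)) + (1 / 4) ^ ∑ i, j i) := by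
          refine (abs_sum_le_sum_abs _ _).trans (sum_le_sum fun j _ => ?_)
          refine le_trans ?_ (hpt j)
          have hfac : (∏ i, (-1 : ℝ) ^ j i * ((t i + j i).choose (t i) : ℝ))
              = (∏ i, (-1 : ℝ) ^ j i / ((t i).factorial * (j i).factorial))
                * ∏ i, (((t + j) i).factorial : ℝ) := by
            rw [← prod_mul_distrib]
            refine prod_congr rfl fun i _ => ?_
            have h := Nat.choose_mul_factorial_mul_factorial (Nat.le_add_right (t i) (j i))
            rw [Nat.add_sub_cancel_left] at h
            have h' : ((t i + j i).choose (t i) : ℝ) * (t i).factorial * (j i).factorial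
              = (t i + j i).factorial := by exact_mod_cast h
            rw [Pi.add_apply, ← h']
            field_simp
          have hpow : (∏ i, (-1 : ℝ) ^ j i / ((t i).factorial * (j i).factorial)) / W
                * μ ^ ∑ i, (t + j) i
              = ∏ i, ((-μ) ^ j i / ((j i).factorial : ℝ)) := by
            rw [hW, ← prod_pow_eq_pow_sum, ← prod_div_distrib, ← prod_mul_distrib]
            refine prod_congr rfl fun i _ => ?_
            rw [Pi.add_apply, pow_add, neg_pow μ]
            field_simp
          have hpow' : |(∏ i, (-1 : ℝ) ^ j i / ((t i).factorial * (j i).factorial)) / W|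
                * μ ^ ∑ i, (t + j) i
              = ∏ i, (μ ^ j i / ((j i).factorial : ℝ)) := by
            have h := congrArg abs hpow
            rw [abs_mul, abs_of_pos (by positivity : 0 < μ ^ ∑ i, (t + j) i)] at h
            rw [h, abs_prod]
            refine prod_congr rfl fun i _ => ?_
            rw [abs_div, abs_pow, abs_neg, abs_of_pos hμ, Nat.abs_cast]
          rw [hfac, ← hpow, ← hpow', mul_assoc |_|]
          have e : ∀ c F m w : ℝ, c * F * m / W - c / W * w = c / W * (m * F - w) := by
            intros; ring
          rw [e, abs_mul]
          gcongr
          exact hM (t + j)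
      _ ≤ ε * (Real.exp D ^ r + 2 ^ r) := by
          rw [← mul_sum, sum_add_distrib]
          gcongr
          · exact sum_piFinset_prod_pow_div_factorial_le hD N
          · exact sum_piFinset_geometric_le N
      _ = (Real.exp D ^ r + 2 ^ r) * ε := mul_comm _ _
  have hlim : Tendsto (fun N : ℕ => |Real.exp μ ^ r * (P / W)
      - Real.exp μ ^ r * (∑ k ∈ range (N + 1), (-μ) ^ k / (k.factorial : ℝ)) ^ r|) atTop
      (nhds |Real.exp μ ^ r * (P / W) - 1|) := by
    have h := (NormedSpace.expSeries_div_hasSum_exp (-μ)).tendsto_sum_nat.comp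
      (tendsto_add_atTop_nat 1)
    rw [← Real.exp_eq_exp_ℝ] at h
    have h2 := ((h.pow r).const_mul (Real.exp μ ^ r)).const_sub (Real.exp μ ^ r * (P / W))
    rw [hexp] at h2
    exact h2.abs
  exact le_of_tendsto hlim (eventually_atTop.2 ⟨N₀, hbound⟩)

end InclusionExclusion

/-- If `J ≤ L`, the order is at most `(r + 1) L` and the relative error itself is at most `ε`. If `J
> L` it may be large, but the factorials in the weight beat `J ^ J`, and a factor `exp (-J) ≤ ε` can
be split off. -/
lemma poisson_weight_mul_error_le {ι : Type*} [Fintype ι] {μ κ ε L : ℝ} (hμ : 0 < μ) (hκ : 0 ≤ κ) (hL : 1 ≤ L)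
    (h1 : (Fintype.card ι + 1) ^ 2 * L ^ 2 * κ ≤ 1)
    (h2 : 2 * ((Fintype.card ι + 1) ^ 2 * L ^ 2 * κ) ≤ ε)
    (h3 : Real.exp (-L) ≤ ε)
    (h4 : Real.exp (Fintype.card ι) * (2 * Real.exp 1 * μ * ((Fintype.card ι + 1) * κ))
      ≤ Real.exp (-1) / 4)
    {t : ι → ℕ} (ht : ∀ i, (t i : ℝ) ≤ L) (j : ι → ℕ) :
    (∏ i, μ ^ j i / (j i).factorial)
        * ((1 + (∑ i, (t + j) i : ℕ) * κ) ^ (∑ i, (t + j) i) - 1)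
      ≤ ε * ((∏ i, (2 * Real.exp 2 * μ) ^ j i / (j i).factorial) + (1 / 4) ^ ∑ i, j i) := by
  set r : ℝ := ((Fintype.card ι : ℕ) : ℝ) with hr
  have hr0 : 0 ≤ r := Nat.cast_nonneg _
  set J := ∑ i, j i with hJ
  set τ := ∑ i, t i with hτ
  have hK : ∑ i, (t + j) i = τ + J := sum_add_distrib
  have hε : 0 ≤ ε := (Real.exp_pos _).le.trans h3
  have hτL : (τ : ℝ) ≤ r * L := by
    rw [hτ, Nat.cast_sum]
    calc ∑ i, (t i : ℝ) ≤ ∑ _i : ι, L := sum_le_sum fun i _ => ht i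
      _ = r * L := by rw [sum_const, card_univ, nsmul_eq_mul]
  rw [hK, prod_pow_div_factorial, prod_pow_div_factorial]
  set w : ℝ := (∏ i, ((j i).factorial : ℝ))⁻¹ with hw
  have hw0 : 0 < w := by positivity
  have he2 : 1 ≤ Real.exp 2 := Real.one_le_exp (by norm_num)
  rcases le_or_gt (J : ℝ) L with hJL | hJL
  · have hKL : ((τ + J : ℕ) : ℝ) ≤ (r + 1) * L := by push_cast; linarith
    set y : ℝ := (τ + J : ℕ) * ((τ + J : ℕ) * κ) with hy
    have hy0 : 0 ≤ y := by positivity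
    have hyle : y ≤ (r + 1) ^ 2 * L ^ 2 * κ := by
      calc y ≤ ((r + 1) * L) * (((r + 1) * L) * κ) := by rw [hy]; gcongr
        _ = _ := by ring
    have hpow : (1 + (τ + J : ℕ) * κ) ^ (τ + J) - 1 ≤ ε := by
      have e1 := one_add_mul_pow_le_exp hκ (Nat.cast_nonneg (τ + J)) (τ + J)
      have e2 := Real.abs_exp_sub_one_le (x := y) (by rw [abs_of_nonneg hy0]; linarith)
      rw [abs_of_nonneg hy0] at e2
      linarith [le_abs_self (Real.exp y - 1)]
    calc μ ^ J * w * ((1 + (τ + J : ℕ) * κ) ^ (τ + J) - 1)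
        ≤ μ ^ J * w * ε := by gcongr
      _ ≤ (2 * Real.exp 2 * μ) ^ J * w * ε := by
          gcongr
          nlinarith
      _ ≤ ε * ((2 * Real.exp 2 * μ) ^ J * w + (1 / 4) ^ J) := by
          have : 0 ≤ ε * (1 / 4 : ℝ) ^ J := by positivity
          linarith
  · have hJ0 : (0 : ℝ) < J := by linarith
    have hKJ : ((τ + J : ℕ) : ℝ) ≤ (r + 1) * J := by
      push_cast
      nlinarith
    set x : ℝ := (r + 1) * J * κ with hx
    have hx0 : 0 ≤ x := by positivity
    have hfirst : (1 + x) ^ τ ≤ Real.exp 1 ^ J := by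
      have e1 := one_add_mul_pow_le_exp hκ (by positivity : 0 ≤ (r + 1) * (J : ℝ)) τ
      refine e1.trans ?_
      rw [← Real.exp_nat_mul, mul_one]
      apply Real.exp_le_exp.2
      calc (τ : ℝ) * ((r + 1) * J * κ) ≤ (r * L) * ((r + 1) * J * κ) := by gcongr
        _ = (r * (r + 1) * L * κ) * J := by ring
        _ ≤ 1 * J := by
            gcongr
            refine le_trans ?_ h1
            have : r * (r + 1) * L ≤ (r + 1) ^ 2 * L ^ 2 := by
              have a1 : r * (r + 1) ≤ (r + 1) ^ 2 := by nlinarith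
              have a2 : L ≤ L ^ 2 := by nlinarith
              gcongr
            gcongr
        _ = J := one_mul _
    have hsecond : (1 + x) ^ J ≤ 2 ^ J * (1 + x ^ J) := by
      rcases le_or_gt x 1 with h | h
      · calc (1 + x) ^ J ≤ 2 ^ J := by gcongr; linarith
          _ ≤ 2 ^ J * (1 + x ^ J) := by
              have : 0 ≤ x ^ J := by positivity
              nlinarith [pow_pos (two_pos : (0 : ℝ) < 2) J]
      · calc (1 + x) ^ J ≤ (2 * x) ^ J := by gcongr; linarith
          _ = 2 ^ J * x ^ J := mul_pow _ _ _
          _ ≤ 2 ^ J * (1 + x ^ J) := by gcongr; linarith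
    have hJw : (J : ℝ) ^ J * w ≤ Real.exp r ^ J := by
      rw [hw, hJ, ← prod_pow_div_factorial]
      calc ∏ i, ((∑ i, j i : ℕ) : ℝ) ^ j i / ((j i).factorial : ℝ)
          ≤ ∏ _i : ι, Real.exp (∑ i, j i : ℕ) :=
            prod_le_prod (fun i _ => by positivity)
              fun i _ => pow_div_factorial_le_exp (Nat.cast_nonneg _) _
        _ = Real.exp r ^ (∑ i, j i) := by
            rw [prod_const, card_univ, ← Real.exp_nat_mul, ← Real.exp_nat_mul, mul_comm]
    have heJ : Real.exp (-1) ^ J ≤ ε := by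
      rw [← Real.exp_nat_mul]
      refine le_trans (Real.exp_le_exp.2 ?_) h3
      linarith
    -- The base `2 e² μ` in the conclusion is chosen to leave this spare factor `exp (-1)`.
    have hsplit : 2 * Real.exp 1 * μ = Real.exp (-1) * (2 * Real.exp 2 * μ) := by
      have : Real.exp 1 = Real.exp (-1) * Real.exp 2 := by rw [← Real.exp_add]; norm_num
      rw [this]; ring
    calc μ ^ J * w * ((1 + (τ + J : ℕ) * κ) ^ (τ + J) - 1)
        ≤ μ ^ J * w * ((1 + x) ^ τ * (1 + x) ^ J) := by
          gcongr
          rw [← pow_add]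
          have : (1 + ((τ + J : ℕ) : ℝ) * κ) ^ (τ + J) ≤ (1 + x) ^ (τ + J) := by
            rw [hx]
            gcongr
          linarith
      _ ≤ μ ^ J * w * (Real.exp 1 ^ J * (2 ^ J * (1 + x ^ J))) := by gcongr
      _ = (2 * Real.exp 1 * μ) ^ J * w
            + (2 * Real.exp 1 * μ * ((r + 1) * κ)) ^ J * ((J : ℝ) ^ J * w) := by
          rw [hx]
          simp only [mul_pow]
          ring
      _ ≤ (2 * Real.exp 1 * μ) ^ J * w
            + (2 * Real.exp 1 * μ * ((r + 1) * κ)) ^ J * Real.exp r ^ J := by gcongr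
      _ = Real.exp (-1) ^ J * ((2 * Real.exp 2 * μ) ^ J * w)
            + (Real.exp r * (2 * Real.exp 1 * μ * ((r + 1) * κ))) ^ J := by
          rw [hsplit]
          simp only [mul_pow]
          ring
      _ ≤ Real.exp (-1) ^ J * ((2 * Real.exp 2 * μ) ^ J * w) + (Real.exp (-1) / 4) ^ J := by
          gcongr
      _ = Real.exp (-1) ^ J * ((2 * Real.exp 2 * μ) ^ J * w + (1 / 4) ^ J) := by
          rw [div_eq_mul_one_div, mul_pow (Real.exp (-1)), mul_add]
      _ ≤ ε * ((2 * Real.exp 2 * μ) ^ J * w + (1 / 4) ^ J) := by gcongr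

/-! ### Comparison of the moments with Poisson moments. -/

section FactorialMoments

variable {V : Type*} [Fintype V] [DecidableEq V] {ι : Type*} [Fintype ι]
  {G : SimpleGraph V} [DecidableRel G.Adj] {v : ι → V}

lemma average_neighborFinset_bounds {V : Type*} [Fintype V]
    {G : SimpleGraph V} [DecidableRel G.Adj] {d : ℕ} (hG : G.IsRegularOfDegree d) (hd : 2 ≤ d)
    {u : V} {f : V → ℝ} {lo hi : ℝ} (hlo : ∀ z, G.Adj u z → lo ≤ f z) (hhi : ∀ z, G.Adj u z → f z ≤ hi) :
    lo ≤ (∑ z ∈ G.neighborFinset u, f z) / d ∧ (∑ z ∈ G.neighborFinset u, f z) / d ≤ hi := by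
  have hd0 : (0 : ℝ) < d := by exact_mod_cast (by omega : 0 < d)
  have hcard : #(G.neighborFinset u) = d := by rw [G.card_neighborFinset_eq_degree, hG u]
  rw [le_div_iff₀ hd0, div_le_iff₀ hd0]
  constructor
  · have h := card_nsmul_le_sum (G.neighborFinset u) f lo fun z hz =>
      hlo z ((G.mem_neighborFinset _ _).1 hz)
    rw [hcard, nsmul_eq_mul] at h
    linarith
  · have h := sum_le_card_nsmul (G.neighborFinset u) f hi fun z hz =>
      hhi z ((G.mem_neighborFinset _ _).1 hz)
    rw [hcard, nsmul_eq_mul] at h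
    linarith

/-- The factorial moments of the numbers of visits are close to those of independent Poisson
variables. -/
lemma abs_factorialMoment_sub_le {d : ℕ} (hG : G.IsRegularOfDegree d) (hd : 2 ≤ d)
    (hv : Function.Injective v) (i₀ : ι) (hu : ∀ z, G.Adj (v i₀) z → ∀ i, z ≠ v i)
    {p q a μ κ : ℝ} {T k : ℕ} (hp : 0 ≤ p) (hq : 0 ≤ q) (ha : 0 ≤ a) (hμ : 0 < μ) (hκ : 0 ≤ κ)
    (hT : 1 ≤ T)
    (hup : ∀ (i : ι) (j : ℕ) (x y : V), G.Adj x y → ((∃ l, x = v l) ∨ ∃ l, y = v l) → 1 ≤ j →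
      (nbOp G ((d : ℝ) - 1) ^ j) (fun _ y => if y = v i then 1 else 0) x y
        ≤ p + if j < T then a else 0)
    (hlow : ∀ (i : ι) (j : ℕ) (x y : V), G.Adj x y → T ≤ j →
      q ≤ (nbOp G ((d : ℝ) - 1) ^ j) (fun _ y => if y = v i then 1 else 0) x y)
    (hTa : T * a ≤ μ * κ) (hkp : k * p + T * a ≤ μ * (1 + κ))
    (hqT : q * T ≤ μ * κ) (hkq : μ * (1 - κ) ≤ q * k - q * T) (s : ι → ℕ) :
    |((nbWalk G (v i₀) (k + 1)).expect fun w => chooseProd s fun i => visits w (v i))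
        * (∏ i, ((s i).factorial : ℝ)) - μ ^ ∑ i, s i|
      ≤ μ ^ (∑ i, s i) * ((1 + (∑ i, s i : ℕ) * κ) ^ (∑ i, s i) - 1) := by
  set K := ∑ i, s i with hK
  set F : ℝ := ∏ i, ((s i).factorial : ℝ) with hF
  have hF0 : 0 < F := by positivity
  rw [expect_nbWalk_visits hG hd (v i₀) v hu]
  obtain ⟨h1, h2⟩ := average_neighborFinset_bounds hG hd (u := v i₀)
    (f := fun z => visitMoment G ((d : ℝ) - 1) v k s (v i₀) z)
    (fun z hz => le_visitMoment hG hd hv hq hT hlow K s rfl k _ z hz)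
    (fun z hz => visitMoment_le hG hd hv hp ha le_rfl hup K s rfl k _ z hz (Or.inl ⟨i₀, rfl⟩))
  rw [← div_eq_mul_inv, div_le_iff₀ hF0] at h1
  rw [← div_eq_mul_inv, le_div_iff₀ hF0] at h2
  unfold visitMoment at h1 h2
  set X := (∑ z ∈ G.neighborFinset (v i₀),
    visitExp G ((d : ℝ) - 1) v k (chooseProd s) (v i₀) z) / (d : ℝ) * F with hX
  rcases Nat.eq_zero_or_pos K with h0 | hK1
  · rw [h0] at h1 h2 ⊢
    simp only [pow_zero] at h1 h2 ⊢
    rw [le_antisymm h2 h1]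
    simp
  have hK1' : (1 : ℝ) ≤ K := by exact_mod_cast hK1
  have hbern : 1 + K * (K * κ) ≤ (1 + K * κ) ^ K :=
    one_add_mul_le_pow (by have : 0 ≤ K * κ := by positivity
                           linarith) K
  have hμK : 0 < μ ^ K := by positivity
  have hhi : X ≤ μ ^ K * (1 + K * κ) ^ K := by
    refine h2.trans ?_
    rw [← mul_pow]
    gcongr
    nlinarith
  -- Bernoulli applied twice: `2 - (1 + Kκ) ^ K ≤ 1 - K²κ ≤ (1 - Kκ) ^ K`. For `Kκ > 1` the left
  -- side is nonpositive.
  have hlo : μ ^ K * (2 - (1 + K * κ) ^ K) ≤ X := by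
    refine le_trans ?_ h1
    rcases le_or_gt (K * κ) 1 with hle | hgt
    · have hb2 : 1 + K * (-(K * κ)) ≤ (1 + -(K * κ)) ^ K :=
        one_add_mul_le_pow (by linarith) K
      have hcast : (k : ℝ) - K * T ≤ (k - K * T : ℕ) := by
        have : (k : ℝ) ≤ (k - K * T : ℕ) + (K * T : ℕ) := by exact_mod_cast le_tsub_add
        push_cast at this
        linarith
      calc μ ^ K * (2 - (1 + K * κ) ^ K) ≤ μ ^ K * (1 + -(K * κ)) ^ K := by
            gcongr
            linarith
        _ = (μ * (1 + -(K * κ))) ^ K := (mul_pow _ _ _).symm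
        _ ≤ (q * (k - K * T : ℕ)) ^ K := by
            have h3 : 0 ≤ 1 + -(K * κ) := by linarith
            have h4 : q * ((k : ℝ) - K * T) ≤ q * (k - K * T : ℕ) := by gcongr
            refine pow_le_pow_left₀ (by positivity) (le_trans ?_ h4) K
            nlinarith
    · have : 2 - (1 + K * κ) ^ K ≤ 0 := by nlinarith
      exact (mul_nonpos_of_nonneg_of_nonpos hμK.le this).trans (by positivity)
  rw [abs_le]
  constructor <;> linarith

lemma visits_le {V : Type*} [DecidableEq V] {m : ℕ} (w : Fin (m + 1) → V) (x : V) :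
    visits w x ≤ m := by
  unfold visits
  exact (card_filter_le _ _).trans_eq (card_fin m)

lemma toReal_toOuterMeasure_visits_eq_sum [DecidableEq ι] (u : V) (m : ℕ) (t : ι → ℕ) {N : ℕ}
    (hN : m ≤ N) :
    ((nbWalk G u m).toOuterMeasure {w | ∀ i, visits w (v i) = t i}).toReal
      = ∑ j ∈ Fintype.piFinset fun _ => range (N + 1),
          (∏ i, (-1) ^ j i * ((t i + j i).choose (t i) : ℝ))
            * (nbWalk G u m).expect fun w => chooseProd (t + j) fun i => visits w (v i) := by
  classical
  have h : ∀ w : Fin (m + 1) → V, (if ∀ i, visits w (v i) = t i then (1 : ℝ) else 0)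
      = ∑ j ∈ Fintype.piFinset fun _ => range (N + 1),
          (∏ i, (-1) ^ j i * ((t i + j i).choose (t i) : ℝ))
            * chooseProd (t + j) fun i => visits w (v i) := fun w =>
    ite_forall_eq_alternating_sum (a := fun i => visits w (v i))
      fun i => (visits_le w (v i)).trans hN
  rw [PMF.toReal_toOuterMeasure, ← sum_congr rfl fun j _ => PMF.expect_const_mul _ _ _,
    ← PMF.expect_sum]
  refine PMF.expect_congr fun w _ => ?_
  rw [← h w]
  congr

end FactorialMoments

/-! ### Asymptotics in `log n`. -/

section Asymptotics

lemma eventually_mul_log_rpow_le (B s : ℝ) :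
    ∀ᶠ n : ℕ in atTop, B * Real.log n ^ s ≤ n := by
  have h := (isLittleO_log_rpow_rpow_atTop s one_pos).const_mul_left B
  have h' := (h.comp_tendsto tendsto_natCast_atTop_atTop).bound one_pos
  filter_upwards [h'] with n hn
  simp only [Function.comp_apply, Real.rpow_one, one_mul, Real.norm_eq_abs, Nat.abs_cast] at hn
  exact (le_abs_self _).trans hn

lemma tendsto_log_natCast : Tendsto (fun n : ℕ => Real.log n) atTop atTop :=
  Real.tendsto_log_atTop.comp tendsto_natCast_atTop_atTop

lemma eventually_log_rpow_neg_le {δ θ : ℝ} (hδ : 0 < δ) (hθ : 0 < θ) :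
    ∀ᶠ n : ℕ in atTop, Real.log n ^ (-δ) ≤ θ :=
  ((tendsto_rpow_neg_atTop hδ).comp tendsto_log_natCast).eventually_le_const hθ

/-- After a logarithmic number of steps, the mixing error is polynomially small. -/
lemma exists_mixing_time {ρ : ℝ} (hρ : 0 < ρ) (hρ1 : ρ < 1) :
    ∃ A : ℝ, 0 < A ∧ ∀ᶠ n : ℕ in atTop, ∀ k : ℕ, A * Real.log n ≤ k →
      2 * ((k + 1) * ρ ^ k) ≤ 1 / (n : ℝ) ^ 2 := by
  -- In `ρ ^ k = σ ^ k * σ ^ k` one factor absorbs `k + 1` and the other gives `n⁻³`; one power of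
  -- `n` pays for the constant.
  set σ := Real.sqrt ρ with hσ
  have hσ0 : 0 < σ := Real.sqrt_pos.2 hρ
  have hσ1 : σ < 1 := by
    rw [hσ, Real.sqrt_lt' one_pos]
    simpa using hρ1
  have hσ2 : σ ^ 2 = ρ := Real.sq_sqrt hρ.le
  have hlog : Real.log σ < 0 := Real.log_neg hσ0 hσ1
  set h : ℝ := σ⁻¹ - 1 with hh
  have hh0 : 0 < h := by
    have := (one_lt_inv₀ hσ0).2 hσ1
    linarith
  have hlin : ∀ k : ℕ, ((k : ℝ) + 1) * σ ^ k ≤ 1 + h⁻¹ := by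
    intro k
    have hb : 1 + k * h ≤ (1 + h) ^ k := one_add_mul_le_pow (by linarith) k
    have e : 1 + h = σ⁻¹ := by rw [hh]; ring
    rw [e, inv_pow] at hb
    have hpos : 0 < σ ^ k := by positivity
    have hk : (k : ℝ) + 1 ≤ (1 + h⁻¹) * (1 + k * h) := by
      have : (1 + h⁻¹) * (1 + k * h) = 1 + k * h + h⁻¹ + k := by field_simp; ring
      rw [this]
      have : 0 ≤ k * h + h⁻¹ := by positivity
      linarith
    calc ((k : ℝ) + 1) * σ ^ k ≤ ((1 + h⁻¹) * (σ ^ k)⁻¹) * σ ^ k := by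
          gcongr
          exact hk.trans (by gcongr)
      _ = 1 + h⁻¹ := by field_simp
  refine ⟨3 / (-Real.log σ), div_pos (by norm_num) (by linarith), ?_⟩
  filter_upwards [eventually_ge_atTop 1, eventually_ge_atTop ⌈2 * (1 + h⁻¹)⌉₊] with n hn1 hn k hk
  have hn0 : (0 : ℝ) < n := by exact_mod_cast hn1
  have hn' : 2 * (1 + h⁻¹) ≤ n := (Nat.le_ceil _).trans (by exact_mod_cast hn)
  have hσk : σ ^ k ≤ 1 / (n : ℝ) ^ 3 := by
    rw [div_mul_eq_mul_div, div_le_iff₀ (by linarith)] at hk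
    have e1 : σ ^ k = Real.exp (k * Real.log σ) := by
      rw [Real.exp_nat_mul, Real.exp_log hσ0]
    have e2 : 1 / (n : ℝ) ^ 3 = Real.exp (-(3 * Real.log n)) := by
      rw [Real.exp_neg, one_div, ← Real.exp_log hn0, ← Real.exp_nat_mul, Real.log_exp]
      norm_num
    rw [e1, e2]
    apply Real.exp_le_exp.2
    linarith
  calc 2 * ((k + 1) * ρ ^ k) = 2 * ((k + 1) * σ ^ k) * σ ^ k := by rw [← hσ2]; ring
    _ ≤ 2 * (1 + h⁻¹) * (1 / (n : ℝ) ^ 3) := by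
        gcongr
        exact hlin k
    _ ≤ n * (1 / (n : ℝ) ^ 3) := by gcongr
    _ = 1 / (n : ℝ) ^ 2 := by field_simp

end Asymptotics

/-! ### Choice of parameters and conclusion. -/

/-- The walk started near the vertices `v i` is unlikely to be at one of them at any given later
time. -/
lemma nbOp_pow_indicator_le_log_rpow {V : Type*} [Fintype V] [DecidableEq V] {ι : Type*}
    {G : SimpleGraph V} [DecidableRel G.Adj] {v : ι → V} {d : ℕ} (hd : 3 ≤ d)
    (hG : G.IsRegularOfDegree d) {c g L : ℝ} (hL : 0 < L)
    (hcg : c * Real.logb ((d : ℝ) - 1) L ≤ g) (hg0 : 0 < g) (hg : g ≤ G.girth)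
    (hdist : ∀ i j, i ≠ j → g ≤ G.dist (v i) (v j)) (i : ι) {j : ℕ} (hj : 1 ≤ j) {x y : V}
    (hxy : G.Adj x y) (hgood : (∃ l, x = v l) ∨ ∃ l, y = v l) :
    (nbOp G ((d : ℝ) - 1) ^ j) (fun _ y => if y = v i then 1 else 0) x y
      ≤ ((d : ℝ) - 1) * L ^ (-(c / 2)) := by
  have hd' : (3 : ℝ) ≤ d := by exact_mod_cast hd
  set b : ℝ := (d : ℝ) - 1 with hb
  have hb1 : 1 < b := by linarith
  have hb0 : 0 < b := by linarith
  -- `h` is the largest integer below `g / 2`; rounding costs the factor `d - 1`.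
  obtain ⟨h, hh⟩ : ∃ h, ⌈g / 2⌉₊ = h + 1 :=
    Nat.exists_eq_succ_of_ne_zero (Nat.ceil_pos.2 (by linarith)).ne'
  have hlt : (h : ℝ) < g / 2 := by
    have := Nat.ceil_lt_add_one (by linarith : 0 ≤ g / 2)
    rw [hh] at this
    push_cast at this
    linarith
  have hge : g / 2 ≤ (h : ℝ) + 1 := by
    have := Nat.le_ceil (g / 2)
    rw [hh] at this
    exact_mod_cast this
  rcases lt_or_ge j h with hjh | hjh
  · rw [nbOp_pow_indicator_eq_zero hg hdist hj _ i hxy hgood]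
    · positivity
    · have : (j : ℝ) + 1 ≤ h := by exact_mod_cast hjh
      linarith
  · have h2 : 2 * h < G.girth := by
      have : (2 : ℝ) * h < G.girth := by linarith
      exact_mod_cast this
    refine (nbOp_pow_indicator_le (by omega) hG h2 hjh (v i) hxy).trans ?_
    have e1 : (1 / b) ^ h = b * b ^ (-((h : ℝ) + 1)) := by
      rw [Real.rpow_neg hb0.le, Real.rpow_add hb0, Real.rpow_natCast, Real.rpow_one, one_div,
        inv_pow]
      field_simp
    have e2 : L ^ (-(c / 2)) = b ^ (Real.logb b L * (-(c / 2))) := by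
      rw [Real.rpow_mul hb0.le, Real.rpow_logb hb0 hb1.ne' hL]
    rw [e1, e2]
    refine mul_le_mul_of_nonneg_left (Real.rpow_le_rpow_of_exponent_le hb1.le ?_) hb0.le
    linarith

/-- Here `p, q = 1/n ± 1/n²`. As `k` is the walk length minus one, rounding leaves it up to 2 below
`μ n`. -/
lemma abs_factorialMoment_sub_le_of_mixing {V : Type*} [Fintype V] [DecidableEq V] {ι : Type*}
    [Fintype ι] {G : SimpleGraph V} [DecidableRel G.Adj] {v : ι → V} {d n : ℕ}
    (hG : G.IsRegularOfDegree d) (hd : 2 ≤ d) (hn : 1 ≤ n) (hv : Function.Injective v) (i₀ : ι)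
    (hu : ∀ z, G.Adj (v i₀) z → ∀ i, z ≠ v i) {μ κ a : ℝ} {T k : ℕ} (hμ : 0 < μ) (hκ : 0 ≤ κ)
    (ha : 0 ≤ a) (hT : 1 ≤ T)
    (hmixing : ∀ (i : ι) (j : ℕ) (x y : V), G.Adj x y → T ≤ j →
      |(nbOp G ((d : ℝ) - 1) ^ j) (fun _ y => if y = v i then 1 else 0) x y - 1 / n|
        ≤ 1 / (n : ℝ) ^ 2)
    (hlocal : ∀ (i : ι) (j : ℕ) (x y : V), G.Adj x y → ((∃ l, x = v l) ∨ ∃ l, y = v l) → 1 ≤ j →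
      (nbOp G ((d : ℝ) - 1) ^ j) (fun _ y => if y = v i then 1 else 0) x y ≤ a)
    (hTa : (2 + T + μ) / n + T * a ≤ μ * κ) (hk1 : (k : ℝ) ≤ μ * n) (hk2 : μ * n - 2 ≤ k)
    (s : ι → ℕ) :
    |((nbWalk G (v i₀) (k + 1)).expect fun w => chooseProd s fun i => visits w (v i))
        * (∏ i, ((s i).factorial : ℝ)) - μ ^ ∑ i, s i|
      ≤ μ ^ (∑ i, s i) * ((1 + (∑ i, s i : ℕ) * κ) ^ (∑ i, s i) - 1) := by
  have hn0 : (0 : ℝ) < n := by exact_mod_cast hn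
  have hn1 : (1 : ℝ) ≤ n := by exact_mod_cast hn
  set p : ℝ := 1 / n + 1 / (n : ℝ) ^ 2 with hp
  set q : ℝ := 1 / n - 1 / (n : ℝ) ^ 2 with hq
  have hp0 : 0 ≤ p := by positivity
  have hq0 : 0 ≤ q := by
    rw [hq, sub_nonneg]
    apply one_div_le_one_div_of_le hn0
    nlinarith
  have hq1 : q ≤ 1 / n := by
    have : 0 ≤ 1 / (n : ℝ) ^ 2 := by positivity
    rw [hq]; linarith
  have hsplit : (2 + T + μ) / (n : ℝ) = 2 / n + T / n + μ / n := by ring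
  have hTa0 : 0 ≤ T * a := by positivity
  have h2n : 0 ≤ 2 / (n : ℝ) := by positivity
  have hTn : 0 ≤ (T : ℝ) / n := by positivity
  have hμn : 0 ≤ μ / n := by positivity
  apply abs_factorialMoment_sub_le (p := p) (q := q) (a := a) (T := T) hG hd hv i₀ hu hp0 hq0 ha hμ
    hκ hT
  · intro i j x y hxy hgood hj
    split_ifs with hjT
    · linarith [hlocal i j x y hxy hgood hj]
    · have := (abs_le.1 (hmixing i j x y hxy (by omega))).2
      rw [hp]; linarith
  · intro i j x y hxy hj
    have := (abs_le.1 (hmixing i j x y hxy hj)).1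
    rw [hq]; linarith
  · linarith
  · have h1 : k * p ≤ (μ * n) * p := by gcongr
    have h2 : (μ * n) * p = μ + μ / n := by rw [hp]; field_simp
    linarith
  · have h1 : q * T ≤ 1 / n * T := by gcongr
    rw [one_div_mul_eq_div] at h1
    linarith
  · have h1 : q * (μ * n - 2 - T) ≤ q * (k - T) := by gcongr
    have h2 : q * (μ * n - 2 - T) = μ - μ / n - 2 / n - T / n + (2 + T) / (n : ℝ) ^ 2 := by
      rw [hq]; field_simp; ring
    have h3 : 0 ≤ (2 + T) / (n : ℝ) ^ 2 := by positivity
    rw [← mul_sub]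
    linarith

theorem proposition4 (d : ℕ) (hd : 3 ≤ d) (lam : ℝ) (hlam : lam < d) (r : ℕ) (hr : 0 < r)
    (μ : ℝ≥0) (hμ : 0 < μ) (c : ℝ) (hc : 6 < c) :
    ∃ C : ℝ, ∀ᶠ n : ℕ in atTop,
      ∀ (V : Type*) [Fintype V] [DecidableEq V] (G : SimpleGraph V) [DecidableRel G.Adj]
        (lam' : ℝ), lam' ≤ lam → IsNDLambdaGraph G n d lam' →
      ∀ g : ℝ, c * Real.logb ((d : ℝ) - 1) (Real.log n) ≤ g → g ≤ (G.girth : ℝ) →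
      ∀ v : Fin r → V, (∀ i j, i ≠ j → g ≤ (G.dist (v i) (v j) : ℝ)) →
      ∀ m : ℕ, |(m : ℝ) - μ * n| < 1 →
      ∀ t : Fin r → ℕ, (∀ i, t i ≤ ⌊Real.log n⌋₊) →
        |((nbWalk G (v ⟨0, hr⟩) m).toOuterMeasure {w | ∀ i, visits w (v i) = t i}).toReal /
            ∏ i, (ProbabilityTheory.poissonMeasure μ).real {t i} - 1|
          ≤ C * Real.log n ^ ((6 - c) / 4) := by
  have hd' : (3 : ℝ) ≤ d := by exact_mod_cast hd
  set b : ℝ := (d : ℝ) - 1 with hb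
  have hb1 : 1 < b := by linarith
  have hb0 : 0 < b := by linarith
  have hμ' : (0 : ℝ) < μ := by exact_mod_cast hμ
  obtain ⟨ρ, hρ0, hρ1, hρb, hρlam⟩ := exists_contraction_rate hb1 (by linarith : lam < b + 1)
  obtain ⟨A, hA0, hmix⟩ := exists_mixing_time hρ0 hρ1
  set δ : ℝ := (c - 6) / 4 with hδ
  have hδ0 : 0 < δ := by rw [hδ]; linarith
  -- With `κ = C₂ S`, the summand 1 pays for the `O(L / n)` errors and the other for the quick
  -- returns `T a`.
  set C₂ : ℝ := 1 + (A + 2) * b / μ with hC₂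
  have hC₂1 : 1 ≤ C₂ := by
    have : 0 ≤ (A + 2) * b / μ := by positivity
    linarith
  set B : ℝ := (A + 4 + μ) / μ with hB
  have hμB : μ * B = A + 4 + μ := by rw [hB]; field_simp
  set c₁ : ℝ := 2 * ((r + 1) ^ 2 * C₂) with hc₁
  set c₂ : ℝ := Real.exp r * (2 * Real.exp 1 * μ * ((r + 1) * C₂)) with hc₂
  have hc₁0 : 0 < c₁ := by positivity
  have hc₂0 : 0 < c₂ := by positivity
  refine ⟨Real.exp μ ^ r * (Real.exp (2 * Real.exp 2 * μ) ^ r + 2 ^ r), ?_⟩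
  filter_upwards [hmix, eventually_ge_atTop 1, eventually_ge_atTop ⌈(μ : ℝ)⁻¹⌉₊,
    tendsto_log_natCast.eventually_ge_atTop 1,
    tendsto_log_natCast.eventually_gt_atTop (b ^ (1 / c)),
    eventually_log_rpow_neg_le hδ0 one_pos,
    eventually_log_rpow_neg_le hδ0 (one_div_pos.2 hc₁0),
    eventually_log_rpow_neg_le hδ0 (div_pos (div_pos (Real.exp_pos (-1)) four_pos) hc₂0),
    eventually_mul_log_rpow_le 1 δ, eventually_mul_log_rpow_le B (c / 2)]
    with n hmixn hn1 hnμ hL1 hLb hε1 hεc₁ hεc₂ hnδ hnB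
  intro V _ _ G _ lam' hlam' hG g hcg hg v hdist m hm t ht
  set L := Real.log n with hL
  have hL0 : 0 < L := by linarith
  have hn0 : (0 : ℝ) < n := by exact_mod_cast hn1
  set ε : ℝ := L ^ (-δ) with hε
  have hε0 : 0 < ε := Real.rpow_pos_of_pos hL0 _
  set S : ℝ := L ^ (1 - c / 2) with hS
  have hS0 : 0 < S := Real.rpow_pos_of_pos hL0 _
  have hSL : S * L ^ (c / 2) = L := by
    rw [hS, ← Real.rpow_add hL0]
    simp
  -- The error is of order `ε²`; the spare factor `ε` absorbs `c₁`.
  have hSε : S * L ^ 2 = ε ^ 2 := by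
    rw [hS, hε, ← Real.rpow_natCast, ← Real.rpow_natCast, ← Real.rpow_add hL0,
      ← Real.rpow_mul hL0.le]
    congr 1
    rw [hδ]
    push_cast
    ring
  have hBLn : B * L / n ≤ S := by
    rw [div_le_iff₀ hn0]
    calc B * L = S * (B * L ^ (c / 2)) := by linear_combination (-B) * hSL
      _ ≤ S * n := by gcongr
  set κ : ℝ := C₂ * S with hκ
  have hκ0 : 0 < κ := by positivity
  have hSεle : S ≤ ε ^ 2 := by
    rw [← hSε]
    exact le_mul_of_one_le_right hS0.le (one_le_pow₀ hL1)
  have hε2 : ε ^ 2 ≤ ε := pow_le_of_le_one hε0.le hε1 two_ne_zero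
  -- This makes the `v i` distinct and pairwise non-adjacent, so the first step visits none of them.
  have hg1 : 1 < g := by
    have h1 : 1 / c < Real.logb b L := (Real.lt_logb_iff_rpow_lt hb1 hL0).2 hLb
    rw [div_lt_iff₀ (by linarith)] at h1
    linarith
  have hinj : Function.Injective v := by
    intro i j hij
    by_contra hne
    have := hdist i j hne
    rw [hij, SimpleGraph.dist_self] at this
    norm_num at this
    linarith
  have hu : ∀ z, G.Adj (v ⟨0, hr⟩) z → ∀ i, z ≠ v i := by
    rintro z hz i rfl
    by_cases hi : ⟨0, hr⟩ = i
    · exact hz.ne (by rw [hi])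
    · have := hdist _ _ hi
      rw [SimpleGraph.dist_eq_one_iff_adj.2 hz] at this
      norm_num at this
      linarith
  set T : ℕ := ⌈A * L⌉₊ + 1 with hT
  have hTle : (T : ℝ) ≤ (A + 2) * L := by
    have := Nat.ceil_lt_add_one (by positivity : 0 ≤ A * L)
    rw [hT]
    push_cast
    linarith
  set a : ℝ := b * L ^ (-(c / 2)) with ha
  have ha0 : 0 ≤ a := by positivity
  have hmixing : ∀ (i : Fin r) (j : ℕ) (x y : V), G.Adj x y → T ≤ j →
      |(nbOp G b ^ j) (fun _ y => if y = v i then 1 else 0) x y - 1 / n| ≤ 1 / (n : ℝ) ^ 2 := by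
    intro i j x y hxy hj
    refine (nbOp_pow_indicator_mixing (by omega) hG (by linarith) hρ0 hρ1.le hρb ?_ j (v i)
      hxy).trans (hmixn j ?_)
    · have : lam' / b * ρ ≤ lam / b * ρ := by gcongr
      linarith
    · calc A * L ≤ ⌈A * L⌉₊ := Nat.le_ceil _
        _ ≤ j := by exact_mod_cast (by omega : ⌈A * L⌉₊ ≤ j)
  have hlocal : ∀ (i : Fin r) (j : ℕ) (x y : V), G.Adj x y →
      ((∃ l, x = v l) ∨ ∃ l, y = v l) → 1 ≤ j →
      (nbOp G b ^ j) (fun _ y => if y = v i then 1 else 0) x y ≤ a :=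
    fun i j x y hxy hgood hj =>
      nbOp_pow_indicator_le_log_rpow hd hG.regular hL0 hcg (by linarith) hg hdist i hj hxy hgood
  have hμn : 1 ≤ μ * (n : ℝ) := by
    have h1 : (μ : ℝ)⁻¹ ≤ n := (Nat.le_ceil _).trans (by exact_mod_cast hnμ)
    calc (1 : ℝ) = μ * (μ : ℝ)⁻¹ := by field_simp
      _ ≤ μ * n := by gcongr
  obtain ⟨hm1, hm2⟩ := abs_lt.1 hm
  have hm0 : 0 < m := by
    have : (0 : ℝ) < m := by linarith
    exact_mod_cast this
  obtain ⟨k, rfl⟩ := Nat.exists_eq_succ_of_ne_zero hm0.ne'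
  simp only [Nat.succ_eq_add_one] at *
  push_cast at hm1 hm2
  have hTa : T * a ≤ (A + 2) * b * S := by
    have e : L * L ^ (-(c / 2)) = S := by
      rw [hS, sub_eq_add_neg, Real.rpow_add hL0, Real.rpow_one]
    calc T * a ≤ ((A + 2) * L) * a := by gcongr
      _ = (A + 2) * b * (L * L ^ (-(c / 2))) := by rw [ha]; ring
      _ = _ := by rw [e]
  have hμκ : μ * κ = μ * S + (A + 2) * b * S := by
    rw [hκ, hC₂]; field_simp
  have hμS : (2 + T + μ) / n ≤ μ * S := by
    calc (2 + T + μ) / n ≤ (μ * B * L) / n := by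
          gcongr
          rw [hμB]
          have := le_mul_of_one_le_right hμ'.le hL1
          linarith
      _ = μ * (B * L / n) := by ring
      _ ≤ μ * S := by gcongr
  have hmoments := abs_factorialMoment_sub_le_of_mixing hG.regular (by omega) hn1 hinj ⟨0, hr⟩ hu
    hμ' hκ0.le ha0 (by omega : 1 ≤ T) hmixing hlocal (by rw [hμκ]; linarith) (k := k)
    (by linarith) (by linarith)
  have hκε : (r + 1 : ℝ) ^ 2 * L ^ 2 * κ = c₁ / 2 * ε ^ 2 := by
    rw [hκ, ← hSε, hc₁]; ring
  have hc₁ε : c₁ * ε ≤ 1 := by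
    rw [le_div_iff₀ hc₁0] at hεc₁
    linarith
  have hc₁ε2 : c₁ * ε ^ 2 ≤ ε := by
    rw [pow_two, ← mul_assoc]
    exact mul_le_of_le_one_left hε0.le hc₁ε
  have hweight := fun j => poisson_weight_mul_error_le (ι := Fin r) (μ := μ) (κ := κ) (ε := ε)
    (L := L) hμ' hκ0.le hL1
    (by rw [Fintype.card_fin, hκε]; linarith)
    (by rw [Fintype.card_fin, hκε]; linarith)
    (by
      rw [Real.exp_neg, hL, Real.exp_log hn0, hε, Real.rpow_neg hL0.le]
      gcongr
      linarith)
    (by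
      rw [Fintype.card_fin]
      rw [le_div_iff₀ hc₂0] at hεc₂
      calc Real.exp r * (2 * Real.exp 1 * μ * ((r + 1) * κ)) = S * c₂ := by rw [hκ, hc₂]; ring
        _ ≤ ε * c₂ := by
          gcongr
          linarith
        _ ≤ _ := hεc₂)
    (t := t) (fun i => (Nat.cast_le.2 (ht i)).trans (Nat.floor_le hL0.le)) j
  have hfinal := abs_div_prod_poisson_sub_one_le (D := 2 * Real.exp 2 * μ) hμ' (by positivity)
    hε0.le (N₀ := k + 1)
    (fun N hN => toReal_toOuterMeasure_visits_eq_sum (G := G) (v := v) (v ⟨0, hr⟩) (k + 1) t hN)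
    hmoments hweight
  rw [Fintype.card_fin] at hfinal
  have hexp : (6 - c) / 4 = -δ := by rw [hδ]; ring
  rw [hexp, prod_congr rfl fun i _ => ProbabilityTheory.poissonMeasure_real_singleton μ (t i)]
  exact hfinal
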